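/- **Interpretation theorem for ML.** Work with the unimodal modal $\mu$-calculus $L_\mu$ in positive form. All sentences are guarded (each fixpoint variable is in the scope of a modality within its binding) and each fixpoint variable $X$ has a unique binding formula $\phi_X$. Trees are regular and finitely branching, with finitely many propositional variables as labels. $\mathfrak T\models\Psi$ means that Even wins the model-checking parity game of $\mathfrak T$ and $\Psi$ for an order-preserving priority assignment $\Omega$ ($\mu$-variables get odd and $\nu$-variables even priorities; $\Omega(X)\ge\Omega(Y)$ if $X$ is free in $\phi_Y$). For an assignment with values in $I=\{l,\dots,q\}$, $l\in\{0,1\}$, the arena $\mathfrak T\times\Psi$ has positions $(s,\phi)$, with $s$ a state and $\phi$ a subformula of $\Psi$; $(s,X)$ has priority $\Omega(X)$ and other positions have priority $l$. Modal positions $(s,\Diamond\phi)$, $(s,\Box\phi)$ are marked. An arena is encoded as a tree (its unfolding from the initial position) by labelling a position of priority $i$ with $E_i$ if it belongs to Even, with $O_i$ if it belongs to Odd, and also with $M$ if it is marked. A formula is *modal* if it has no fixpoints and no fixpoint variables, and $\Psi$ is *semantically modal* if it is equivalent to a modal formula; its *semantic modal depth* is the least modal depth of such a formula. $\Phi$ *interprets*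 $\Psi$ if for all trees $\mathfrak T$: $\mathfrak T\models\Psi$ if and only if $\mathfrak T\times\Psi\models\Phi$. For fixed $I$ and $p$ put $E=\bigvee_{i\in I}E_i$, $O=\bigvee_{i\in I}O_i$, and define $B_{a,b}$ by $B_{0,b}=\bot$ and, for $a\geq 1$, $$B_{a,0}=(E\wedge\neg M\wedge\Diamond B_{a-1,0})\vee(E\wedge M\wedge\bot)\vee(O\wedge\neg M\wedge\Box B_{a-1,0})\vee(O\wedge M\wedge\top),$$ $$B_{a,b}=(E\wedge\neg M\wedge\Diamond B_{a-1,b})\vee(E\wedge M\wedge\Diamond B_{p,b-1})\vee(O\wedge\neg M\wedge\Box B_{a-1,b})\vee(O\wedge M\wedge\Box B_{p,b-1})\quad(b\ge1).$$ Let $\mathsf{Bounded}_{p,n}=B_{p,n}$. For a sentence $\Psi$ let $p(\Psi)$ be the largest number of nodes on a path of its parse tree (with $\phi_X$ taken as the child of $X$) that contains no modality except possibly as its last node. The *$n$-bounded game* on an arena with marked positions is the parity game with a counter, initially $n$, that is decremented whenever a marked position is seen; if a marked position is reached at counter value $0$, its owner loses. 1. There is an algorithm that, given a semantically modal sentence $\Psi$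 and $l\in\{0,1\}$, $q\ge l$, outputs a modal formula $\Phi$ which interprets $\Psi$, for every order-preserving priority assignment of $\Psi$ with values in $I=\{l,\dots,q\}$. Moreover $\Phi=\mathsf{Bounded}_{p,m}$, where $p=p(\Psi)$ and $m$ is the semantic modal depth of $\Psi$. 2. For every arena $A$ with priorities in $I$ and a set of marked positions such that every path with no marked position, except possibly the last, has at most $p$ positions, and for every $n$, the tree encoding of $A$ satisfies $\mathsf{Bounded}_{p,n}$ if and only if Even wins the $n$-bounded game on $A$. 3. For every sentence $\Psi$ with an order-preserving priority assignment, and every tree $\mathfrak T$, the arena $\mathfrak T\times\Psi$ satisfies the condition on paths of item 2 with $p=p(\Psi)$; and for every $n$, Even wins the $n$-bounded game on $\mathfrak T\times\Psi$ if and only if she wins the parity game $\mathfrak T|^n\times\Psi$, where $\mathfrak T|^n$ is the initial fragment of $\mathfrak T$ up to depth $n$. -/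

import Mathlib

open Filter Relation

namespace Lmu

/-! ### Syntax of the unimodal mu-calculus -/

/-- The two fixpoint binders. -/
inductive Binder where
  | mu
  | nu

/-- Formulas of the unimodal mu-calculus in positive form, over propositional variables `α`;
fixpoint variables are natural numbers. -/
inductive Formula (α : Type) where
  | pos (P : α)
  | neg (P : α)
  | var (X : ℕ)
  | and (φ ψ : Formula α)
  | or (φ ψ : Formula α)
  | dia (φ : Formula α)
  | box (φ : Formula α)
  | fix (η : Binder) (X : ℕ) (φ : Formula α)
  | bot
  | top

namespace Formula

variable {α : Type}

/-- The set of subformulas. -/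
def sub : Formula α → Set (Formula α)
  | and φ ψ => {and φ ψ} ∪ (sub φ ∪ sub ψ)
  | or φ ψ => {or φ ψ} ∪ (sub φ ∪ sub ψ)
  | dia φ => {dia φ} ∪ sub φ
  | box φ => {box φ} ∪ sub φ
  | fix η X φ => {fix η X φ} ∪ sub φ
  | χ => {χ}

theorem self_mem_sub (φ : Formula α) : φ ∈ sub φ := by
  cases φ <;> simp [sub]

/-- The free fixpoint variables. -/
def free : Formula α → Set ℕ
  | var X => {X}
  | and φ ψ => free φ ∪ free ψ
  | or φ ψ => free φ ∪ free ψ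
  | dia φ => free φ
  | box φ => free φ
  | fix _ X φ => free φ \ {X}
  | _ => ∅

/-- A sentence has no free fixpoint variables. -/
def IsSentence (Ψ : Formula α) : Prop := free Ψ = ∅

/-- Every fixpoint variable has only one binding formula, so that "the formula binding `X`"
makes sense. -/
def WellNamed (Ψ : Formula α) : Prop :=
  ∀ X η η' φ φ', fix η X φ ∈ sub Ψ → fix η' X φ' ∈ sub Ψ → η = η' ∧ φ = φ'

/-- Every free occurrence of `X` is in the scope of a modality. -/
def GuardedIn (X : ℕ) : Formula α → Prop
  | var Y => Y ≠ X
  | and φ ψ => GuardedIn X φ ∧ GuardedIn X ψ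
  | or φ ψ => GuardedIn X φ ∧ GuardedIn X ψ
  | fix _ Y φ => Y = X ∨ GuardedIn X φ
  | _ => True

/-- Every fixpoint variable is in the scope of a modality within its binding. -/
def Guarded (Ψ : Formula α) : Prop :=
  ∀ η X φ, fix η X φ ∈ sub Ψ → GuardedIn X φ

/-- Syntactically modal sentences: no fixpoints and no fixpoint variables. -/
def IsModal : Formula α → Prop
  | var _ => False
  | fix _ _ _ => False
  | and φ ψ => IsModal φ ∧ IsModal ψ
  | or φ ψ => IsModal φ ∧ IsModal ψ
  | dia φ => IsModal φ
  | box φ => IsModal φ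
  | _ => True

/-- Modal depth: the maximal nesting depth of modalities. -/
def depth : Formula α → ℕ
  | and φ ψ => max (depth φ) (depth ψ)
  | or φ ψ => max (depth φ) (depth ψ)
  | dia φ => depth φ + 1
  | box φ => depth φ + 1
  | fix _ _ φ => depth φ
  | _ => 0

/-- The formula is of the form `◇φ` or `□φ`. -/
def Modality : Formula α → Prop
  | dia _ => True
  | box _ => True
  | _ => False

/-- `Child Ψ φ ψ`: in the parse tree of `Ψ`, with back-edges from fixpoint variables to their
binding formulas, `ψ` is a child of `φ`. -/
inductive Child (Ψ : Formula α) : Formula α → Formula α → Prop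
  | and_left (φ ψ) : Child Ψ (and φ ψ) φ
  | and_right (φ ψ) : Child Ψ (and φ ψ) ψ
  | or_left (φ ψ) : Child Ψ (or φ ψ) φ
  | or_right (φ ψ) : Child Ψ (or φ ψ) ψ
  | dia (φ) : Child Ψ (dia φ) φ
  | box (φ) : Child Ψ (box φ) φ
  | fix (η X φ) : Child Ψ (fix η X φ) φ
  | var (η X φ) : fix η X φ ∈ sub Ψ → Child Ψ (var X) φ

/-- The length, counted in nodes, of the longest path in the parse tree (with back-edges) of `Ψ`
that contains no modality, except possibly as its last node. -/
noncomputable def modalityFreeLength (Ψ : Formula α) : ℕ :=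
  sSup {k | ∃ l : List (Formula α), l.length = k ∧ (∀ φ ∈ l, φ ∈ sub Ψ) ∧
    l.IsChain (Child Ψ) ∧ ∀ φ ∈ l.dropLast, ¬ Modality φ}

/-- Gödel numbering of formulas, given a numbering of the propositional variables. -/
def code (c : α → ℕ) : Formula α → ℕ
  | pos P => Nat.pair 0 (c P)
  | neg P => Nat.pair 1 (c P)
  | var X => Nat.pair 2 X
  | and φ ψ => Nat.pair 3 (Nat.pair (code c φ) (code c ψ))
  | or φ ψ => Nat.pair 4 (Nat.pair (code c φ) (code c ψ))
  | dia φ => Nat.pair 5 (code c φ)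
  | box φ => Nat.pair 6 (code c φ)
  | fix Binder.mu X φ => Nat.pair 7 (Nat.pair X (code c φ))
  | fix Binder.nu X φ => Nat.pair 8 (Nat.pair X (code c φ))
  | bot => Nat.pair 9 0
  | top => Nat.pair 10 0

/-- `Ω` is an order-preserving priority assignment for `Ψ` with co-domain `{l, ..., q}`, where
`l ∈ {0, 1}`. Only the values of `Ω` on the fixpoint variables of `Ψ` matter. -/
structure OrderPreserving (Ψ : Formula α) (l q : ℕ) (Ω : ℕ → ℕ) : Prop where
  le_one : l ≤ 1
  le : l ≤ q
  range : ∀ η X φ, fix η X φ ∈ sub Ψ → l ≤ Ω X ∧ Ω X ≤ q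
  odd_of_mu : ∀ X φ, fix Binder.mu X φ ∈ sub Ψ → Odd (Ω X)
  even_of_nu : ∀ X φ, fix Binder.nu X φ ∈ sub Ψ → Even (Ω X)
  order : ∀ η Y φ X, fix η Y φ ∈ sub Ψ → X ∈ free φ → Ω Y ≤ Ω X

end Formula

/-! ### Trees -/

/-- Rooted labelled transition systems. -/
structure Kripke (α : Type) where
  S : Type
  E : S → S → Prop
  root : S
  label : S → Set α

namespace Kripke

variable {α : Type}

/-- The states of the subtree rooted at `s`. -/
def Below (T : Kripke α) (s : T.S) : Type := {u : T.S // ReflTransGen T.E s u}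

/-- The subtrees rooted at `s` and at `t` are isomorphic. -/
def SubtreeIso (T : Kripke α) (s t : T.S) : Prop :=
  ∃ e : T.Below s ≃ T.Below t,
    (e ⟨s, ReflTransGen.refl⟩).1 = t ∧
    (∀ u v, T.E u.1 v.1 ↔ T.E (e u).1 (e v).1) ∧
    ∀ u, T.label u.1 = T.label (e u).1

/-- Regular finitely branching trees, labelled with finitely many propositional variables. -/
structure IsRegularTree (T : Kripke α) : Prop where
  /-- every state is reachable from the root, -/
  reach : ∀ s, ReflTransGen T.E T.root s
  /-- the root has no predecessor, -/
  root_min : ∀ s, ¬ T.E s T.root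
  /-- and any other state has only one. -/
  pred_unique : ∀ s t u, T.E s u → T.E t u → s = t
  /-- There is finite branching. -/
  finite_branching : ∀ s, {t | T.E s t}.Finite
  /-- Finitely many propositional variables occur. -/
  finite_label : {a | ∃ s, a ∈ T.label s}.Finite
  /-- There are only finitely many subtrees up to isomorphism. -/
  regular : ∃ (n : ℕ) (c : T.S → Fin n), ∀ s t, c s = c t → T.SubtreeIso s t

/-- `s` is reached from the root in exactly `k` steps. -/
def AtDepth (T : Kripke α) : ℕ → T.S → Prop
  | 0, s => s = T.root
  | k + 1, s => ∃ t, T.AtDepth k t ∧ T.E t s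

/-- The initial fragment of a tree up to depth `m`. -/
def truncate (T : Kripke α) (m : ℕ) : Kripke α where
  S := {s : T.S // ∃ k ≤ m, T.AtDepth k s}
  E s t := T.E s.1 t.1
  root := ⟨T.root, 0, Nat.zero_le m, rfl⟩
  label s := T.label s.1

/-- Finite paths that start at the root, indexed by their last state. -/
inductive Path (T : Kripke α) : T.S → Type
  | nil : Path T T.root
  | snoc {s t : T.S} (π : Path T s) (h : T.E s t) : Path T t

/-- The unfolding into a tree. -/
def unfold (T : Kripke α) : Kripke α where
  S := Σ s, Path T s
  E x y := ∃ h : T.E x.1 y.1, y.2 = x.2.snoc h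
  root := ⟨T.root, Path.nil⟩
  label x := T.label x.1

end Kripke

/-! ### Parity games -/

/-- A parity game arena with a set of marked positions. Positions that do not belong to Even
belong to Odd. -/
structure Arena where
  V : Type
  even : V → Prop
  E : V → V → Prop
  init : V
  prio : V → ℕ
  marked : V → Prop

/-- The propositional variables of encoded parity games. -/
inductive GameProp where
  | E (i : ℕ)
  | O (i : ℕ)
  | M

/-- Numbering of the propositional variables of encoded parity games. -/
def GameProp.code : GameProp → ℕ
  | E i => Nat.pair 0 i
  | O i => Nat.pair 1 i
  | M => Nat.pair 2 0

namespace Arena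

/-- Moves that agree with the positional strategy `σ` of Even. -/
def Move (A : Arena) (σ : A.V → A.V) (v w : A.V) : Prop :=
  A.E v w ∧ (A.even v → w = σ v)

/-- Even has a winning (positional) strategy from the initial position: in a finite play that
agrees with it and ends in a position without successors, that position belongs to Odd; in an
infinite play that agrees with it the highest priority seen infinitely often exists and is even. -/
def EvenWins (A : Arena) : Prop :=
  ∃ σ : A.V → A.V,
    (∀ v, A.even v → (∃ w, A.E v w) → A.E v (σ v)) ∧
    (∀ v, ReflTransGen (A.Move σ) A.init v → (∀ w, ¬ A.E v w) → ¬ A.even v) ∧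
    ∀ π : ℕ → A.V, π 0 = A.init → (∀ i, A.Move σ (π i) (π (i + 1))) →
      ∃ d, Even d ∧ (∃ᶠ i in atTop, A.prio (π i) = d) ∧ ∀ᶠ i in atTop, A.prio (π i) ≤ d

/-- The arena as a tree: `E_i` and `O_i` label the positions of priority `i` that belong to Even
and to Odd, and `M` labels the marked positions. -/
def toTree (A : Arena) : Kripke GameProp :=
  Kripke.unfold
    { S := A.V
      E := A.E
      root := A.init
      label := fun v => {a | match a with
        | GameProp.E i => A.even v ∧ A.prio v = i
        | GameProp.O i => ¬ A.even v ∧ A.prio v = i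
        | GameProp.M => A.marked v} }

/-- The `n`-bounded parity game: positions carry the current value of a counter, initially `n`,
which is decremented when a marked position is seen. At a marked position with counter value `0`
the play stops, so that the owner of the position loses. -/
def bounded (A : Arena) (n : ℕ) : Arena where
  V := A.V × ℕ
  even x := A.even x.1
  E x y := A.E x.1 y.1 ∧
    ((¬ A.marked x.1 ∧ y.2 = x.2) ∨ (A.marked x.1 ∧ x.2 = y.2 + 1))
  init := (A.init, n)
  prio x := A.prio x.1
  marked x := A.marked x.1

/-- A path that contains no marked position, except possibly as its last position, consists of at
most `p` positions. In particular a path that starts at a marked position and ends at the next one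
has at most `p` edges, and every infinite path goes through marked positions. -/
def MarksWithin (A : Arena) (p : ℕ) : Prop :=
  ∀ l : List A.V, l.IsChain A.E → (∀ v ∈ l.dropLast, ¬ A.marked v) → l.length ≤ p

end Arena

/-! ### Model-checking games and semantics -/

section Semantics

variable {α : Type}

/-- The edges of the model-checking game. -/
inductive GameEdge (T : Kripke α) (Ψ : Formula α) : T.S × Formula α → T.S × Formula α → Prop
  | and_left (s φ ψ) : GameEdge T Ψ (s, .and φ ψ) (s, φ)
  | and_right (s φ ψ) : GameEdge T Ψ (s, .and φ ψ) (s, ψ)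
  | or_left (s φ ψ) : GameEdge T Ψ (s, .or φ ψ) (s, φ)
  | or_right (s φ ψ) : GameEdge T Ψ (s, .or φ ψ) (s, ψ)
  | dia (s s' φ) : T.E s s' → GameEdge T Ψ (s, .dia φ) (s', φ)
  | box (s s' φ) : T.E s s' → GameEdge T Ψ (s, .box φ) (s', φ)
  | fix (s η X φ) : GameEdge T Ψ (s, .fix η X φ) (s, φ)
  | var (s η X φ) : .fix η X φ ∈ Ψ.sub → GameEdge T Ψ (s, .var X) (s, φ)

/-- The positions `(s, φ)` that belong to Even. Terminal positions belong to the player who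
loses there. -/
def EvenOwns (T : Kripke α) (s : T.S) : Formula α → Prop
  | .pos P => P ∉ T.label s
  | .neg P => P ∈ T.label s
  | .top => False
  | .and _ _ => False
  | .box _ => False
  | _ => True

/-- The model-checking parity game arena of `T` and `Ψ`, for the priority assignment `Ω` with
minimal priority `l`; the modal positions are marked. -/
def game (T : Kripke α) (Ψ : Formula α) (l : ℕ) (Ω : ℕ → ℕ) : Arena where
  V := T.S × {φ : Formula α // φ ∈ Ψ.sub}
  even x := EvenOwns T x.1 x.2.1
  E x y := GameEdge T Ψ (x.1, x.2.1) (y.1, y.2.1)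
  init := (T.root, ⟨Ψ, Ψ.self_mem_sub⟩)
  prio x := match x.2.1 with
    | .var X => Ω X
    | _ => l
  marked x := x.2.1.Modality

/-- Satisfaction: Even wins the model-checking game for an order-preserving priority assignment
(all of these games have the same winner). -/
def Sat (T : Kripke α) (Ψ : Formula α) : Prop :=
  ∃ l q Ω, Ψ.OrderPreserving l q Ω ∧ (game T Ψ l Ω).EvenWins

/-- Two sentences are equivalent if the same trees satisfy them. -/
def Equivalent (Ψ Φ : Formula α) : Prop :=
  ∀ T : Kripke α, T.IsRegularTree → (Sat T Ψ ↔ Sat T Φ)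

/-- Semantically modal: equivalent to a modal formula. -/
def SemanticallyModal (Ψ : Formula α) : Prop :=
  ∃ Φ : Formula α, Φ.IsModal ∧ Equivalent Ψ Φ

/-- The least modal depth of an equivalent modal formula. -/
noncomputable def semanticModalDepth (Ψ : Formula α) : ℕ :=
  sInf {d | ∃ Φ : Formula α, Φ.IsModal ∧ Φ.depth = d ∧ Equivalent Ψ Φ}

/-- `Φ` interprets `Ψ` (with its priority assignment `Ω` of minimal priority `l`): it holds in
the model-checking games of `Ψ`, encoded as trees, exactly when Even wins. -/
def Interprets (Φ : Formula GameProp) (Ψ : Formula α) (l : ℕ) (Ω : ℕ → ℕ) : Prop :=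
  ∀ T : Kripke α, T.IsRegularTree → (Sat T Ψ ↔ Sat (game T Ψ l Ω).toTree Φ)

end Semantics

/-! ### The interpreting formulas -/

/-- The disjunction of a list of formulas. -/
def bigOr {α : Type} : List (Formula α) → Formula α
  | [] => .bot
  | φ :: L => .or φ (bigOr L)

/-- The disjunction of the `E_i` for `l ≤ i ≤ q`. -/
def ownedByEven (l q : ℕ) : Formula GameProp :=
  bigOr ((List.range' l (q + 1 - l)).map fun i => .pos (.E i))

/-- The disjunction of the `O_i` for `l ≤ i ≤ q`. -/
def ownedByOdd (l q : ℕ) : Formula GameProp :=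
  bigOr ((List.range' l (q + 1 - l)).map fun i => .pos (.O i))

/-- The formula `Bounded_{a,b}` for priorities `{l, ..., q}` and path length `p`. -/
def boundedFormula (l q p : ℕ) : ℕ → ℕ → Formula GameProp
  | 0, _ => .bot
  | a + 1, 0 =>
    .or (.and (ownedByEven l q) (.and (.neg .M) (.dia (boundedFormula l q p a 0)))) <|
    .or (.and (ownedByEven l q) (.and (.pos .M) .bot)) <|
    .or (.and (ownedByOdd l q) (.and (.neg .M) (.box (boundedFormula l q p a 0)))) <|
    .and (ownedByOdd l q) (.and (.pos .M) .top)
  | a + 1, b + 1 =>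
    .or (.and (ownedByEven l q) (.and (.neg .M) (.dia (boundedFormula l q p a (b + 1))))) <|
    .or (.and (ownedByEven l q) (.and (.pos .M) (.dia (boundedFormula l q p p b)))) <|
    .or (.and (ownedByOdd l q) (.and (.neg .M) (.box (boundedFormula l q p a (b + 1))))) <|
    .and (ownedByOdd l q) (.and (.pos .M) (.box (boundedFormula l q p p b)))
  termination_by a b => (b, a)

end Lmu

namespace Lmu

/-! ### Games without infinite plays -/

/-! The three items share one reduction: once marked positions recur within `p` positions, parity
disappears. A counter that drops at every mark then excludes infinite plays, so Even wins the
bounded game exactly if she can force Odd to get stuck, a property `Win` defined by induction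
(`Arena.evenWins_iff_win`). One step of that induction is one unfolding of $B_{a,b}$, where $b$ is
the counter and $a$ bounds the number of positions up to the next mark. This gives item 2
(`eval_boundedFormula`).

For item 3, modality-free paths of the parse tree are bounded although variables lead back to their
binding formulas: by guardedness, the variables still unguarded after regenerating $X$ are bound
strictly further out than $X$ (`rank_lt_of_child`). The counter plays the role of the remaining
depth: a state at depth $d$ of $\mathfrak T|^n$ corresponds to counter value $n-d$, and a modal
position at depth $n$ is stuck for lack of successors just as one with counter $0$ is
(`evenWins_truncate_iff_holds`).

For item 1, a modal formula of depth $m$ does not see beyond depth $m$. If $\Psi$ is equivalent to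
one, then $\mathfrak T\models\Psi$ iff $\mathfrak T|^m\models\Psi$ iff Even wins the $m$-bounded
game iff the arena satisfies $B_{p,m}$. It remains to compute $p$ and $m$. The rank bounds the
search for $p$. For $m$, unfolding $\Psi$ through $k$ modalities gives a modal formula of depth at
most $k$ (`exists_modal_holds`), so $m$ is one more than the last $j$ for which truncating some tree
at $j$ and at $j+1$ makes a difference to $\Psi$, or $0$ if there is none. The pairs of sets of
subformulas true at a root under these two truncations form a finite set $D_j$ that is computable
and determines $D_{j+1}$ (`tellsApart_typePairs_iff`). As the $D_j$ range over a finite collection,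
they are eventually periodic with a computable bound on the preperiod, so a bounded search finds the
last difference (`semanticModalDepthOfCode_eq`). -/

/-- The positions from which Even can force Odd to get stuck. -/
inductive Win {V : Type} (even : V → Prop) (E : V → V → Prop) : V → Prop
  | even {v w} : even v → E v w → Win even E w → Win even E v
  | odd {v} : ¬ even v → (∀ w, E v w → Win even E w) → Win even E v

section Win

variable {V V' : Type} {even : V → Prop} {E : V → V → Prop} {even' : V' → Prop}
  {E' : V' → V' → Prop}

theorem win_iff_of_even {v : V} (h : even v) : Win even E v ↔ ∃ w, E v w ∧ Win even E w := by
  constructor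
  · rintro (⟨-, hE, hw⟩ | ⟨hn, -⟩)
    · exact ⟨_, hE, hw⟩
    · exact absurd h hn
  · rintro ⟨w, hE, hw⟩
    exact .even h hE hw

theorem win_iff_of_odd {v : V} (h : ¬ even v) : Win even E v ↔ ∀ w, E v w → Win even E w := by
  constructor
  · rintro (⟨he, -, -⟩ | ⟨-, hw⟩)
    · exact absurd he h
    · exact hw
  · exact .odd h

/-- Zig copies the move chosen by Even and zag pulls back the answers of Odd. The induction is on
the win itself, so neither arena has to be well-founded. -/
theorem Win.of_bisim (Z : V → V' → Prop) (hev : ∀ v v', Z v v' → (even v ↔ even' v'))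
    (zig : ∀ v v' w, Z v v' → E v w → ∃ w', E' v' w' ∧ Z w w')
    (zag : ∀ v v' w', Z v v' → E' v' w' → ∃ w, E v w ∧ Z w w')
    {v : V} (h : Win even E v) : ∀ {v' : V'}, Z v v' → Win even' E' v' := by
  induction h with
  | even he hE _ ih =>
    intro v' hz
    obtain ⟨w', hE', hz'⟩ := zig _ _ _ hz hE
    exact .even ((hev _ _ hz).1 he) hE' (ih hz')
  | odd ho _ ih =>
    intro v' hz
    refine .odd (fun h => ho ((hev _ _ hz).2 h)) fun w' hE' => ?_
    obtain ⟨w, hE, hz'⟩ := zag _ _ _ hz hE'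
    exact ih w hE hz'

theorem win_iff_of_bisim (Z : V → V' → Prop) (hev : ∀ v v', Z v v' → (even v ↔ even' v'))
    (zig : ∀ v v' w, Z v v' → E v w → ∃ w', E' v' w' ∧ Z w w')
    (zag : ∀ v v' w', Z v v' → E' v' w' → ∃ w, E v w ∧ Z w w')
    {v : V} {v' : V'} (hz : Z v v') : Win even E v ↔ Win even' E' v' :=
  ⟨fun h => h.of_bisim Z hev zig zag hz,
   fun h => h.of_bisim (fun a b => Z b a) (fun a b hz => (hev b a hz).symm)
    (fun a b w hz hE => zag b a w hz hE) (fun a b w hz hE => zig b a w hz hE) hz⟩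

end Win

namespace Arena

/-- Without infinite plays the parity condition is vacuous, and choosing some winning successor at
each position is already a positional winning strategy. -/
theorem evenWins_iff_win (A : Arena) (hwf : WellFounded (flip A.E)) :
    A.EvenWins ↔ Win A.even A.E A.init := by
  classical
  constructor
  · rintro ⟨σ, hσ, hfin, -⟩
    suffices H : ∀ v, ReflTransGen (A.Move σ) A.init v → Win A.even A.E v from H _ .refl
    intro v
    induction v using hwf.induction with
    | _ v ih =>
      intro hv
      by_cases he : A.even v
      · have hs : ∃ w, A.E v w := by
          by_contra! hn
          exact hfin v hv hn he
        have hE := hσ v he hs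
        exact .even he hE (ih _ hE (hv.tail ⟨hE, fun _ => rfl⟩))
      · exact .odd he fun w hE => ih w hE (hv.tail ⟨hE, fun h => absurd h he⟩)
  · intro hW
    -- The second branch is needed because a strategy must be legal at every position of Even that
    -- has a successor, also at those she does not win.
    let σ : A.V → A.V := fun v =>
      if h : ∃ w, A.E v w ∧ Win A.even A.E w then h.choose
      else if h : ∃ w, A.E v w then h.choose else v
    have hσ₁ : ∀ v, (∃ w, A.E v w ∧ Win A.even A.E w) →
        A.E v (σ v) ∧ Win A.even A.E (σ v) := by
      intro v h
      simp only [σ, dif_pos h]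
      exact h.choose_spec
    have hreach : ∀ v, ReflTransGen (A.Move σ) A.init v → Win A.even A.E v := by
      intro v hv
      induction hv with
      | refl => exact hW
      | tail _ hm ih =>
        rename_i u w _
        by_cases he : A.even u
        · rw [hm.2 he]
          exact (hσ₁ u ((win_iff_of_even he).1 ih)).2
        · exact (win_iff_of_odd he).1 ih w hm.1
    refine ⟨σ, ?_, ?_, ?_⟩
    · intro v _ hs
      by_cases h : ∃ w, A.E v w ∧ Win A.even A.E w
      · exact (hσ₁ v h).1
      · simp only [σ, dif_neg h, dif_pos hs]
        exact hs.choose_spec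
    · intro v hv hn he
      obtain ⟨w, hE, -⟩ := (win_iff_of_even he).1 (hreach v hv)
      exact hn w hE
    · intro π _ hπ
      exfalso
      suffices H : ∀ v i, π i = v → False from H _ 0 rfl
      intro v
      induction v using hwf.induction with
      | _ v ih =>
        rintro i rfl
        exact ih _ (hπ i).1 (i + 1) rfl

/-- Paths from `v` that contain no marked position, except possibly as the last one, consist of
at most `a` positions. -/
def MarksWithinFrom (A : Arena) (a : ℕ) (v : A.V) : Prop :=
  ∀ l : List A.V, (v :: l).IsChain A.E → (∀ u ∈ (v :: l).dropLast, ¬ A.marked u) →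
    (v :: l).length ≤ a

theorem MarksWithin.from {A : Arena} {p : ℕ} (h : A.MarksWithin p) (v : A.V) :
    A.MarksWithinFrom p v :=
  fun l => h (v :: l)

theorem not_marksWithinFrom_zero (A : Arena) (v : A.V) : ¬ A.MarksWithinFrom 0 v := by
  intro h
  simpa using h [] (by simp) (by simp)

theorem MarksWithinFrom.step {A : Arena} {a : ℕ} {v w : A.V} (h : A.MarksWithinFrom (a + 1) v)
    (hv : ¬ A.marked v) (hE : A.E v w) : A.MarksWithinFrom a w := by
  intro l hl hm
  have := h (w :: l) (by simpa using ⟨hE, hl⟩) (by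
    intro u hu
    rw [List.dropLast_cons_of_ne_nil (by simp)] at hu
    rcases List.mem_cons.1 hu with rfl | hu
    · exact hv
    · exact hm u hu)
  simpa using this

/-- Lexicographic descent: an unmarked move lowers the bound `a` on the positions up to the next
mark, and a marked move lowers the counter `b` and resets `a` to `p`. -/
theorem MarksWithin.wellFounded_bounded {A : Arena} {p : ℕ} (h : A.MarksWithin p) (n : ℕ) :
    WellFounded (flip (A.bounded n).E) := by
  have key : ∀ b a v, A.MarksWithinFrom a v → Acc (flip (A.bounded n).E) (v, b) := by
    intro b
    induction b with
    | zero =>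
      intro a
      induction a with
      | zero => exact fun v hv => absurd hv (A.not_marksWithinFrom_zero v)
      | succ a ih =>
        intro v hv
        refine ⟨_, ?_⟩
        rintro ⟨w, b'⟩ ⟨hE, ⟨hm, rfl⟩ | ⟨-, hb⟩⟩
        · exact ih w (hv.step hm hE)
        · simp at hb
    | succ b ihb =>
      intro a
      induction a with
      | zero => exact fun v hv => absurd hv (A.not_marksWithinFrom_zero v)
      | succ a ih =>
        intro v hv
        refine ⟨_, ?_⟩
        rintro ⟨w, b'⟩ ⟨hE, ⟨hm, rfl⟩ | ⟨-, hb⟩⟩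
        · exact ih w (hv.step hm hE)
        · obtain rfl : b = b' := by simpa using hb
          exact ihb p w (h.from w)
  exact ⟨fun ⟨v, b⟩ => key b p v (h.from v)⟩

/-- Even wins the bounded game from `v` with counter value `b`. -/
def BoundedWin (A : Arena) (b : ℕ) (v : A.V) : Prop :=
  Win (A.bounded 0).even (A.bounded 0).E (v, b)

theorem boundedWin_iff_of_even {A : Arena} {b : ℕ} {v : A.V} (h : A.even v) :
    A.BoundedWin b v ↔ ∃ w j, A.E v w ∧
      ((¬ A.marked v ∧ j = b) ∨ (A.marked v ∧ b = j + 1)) ∧ A.BoundedWin j w := by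
  refine (win_iff_of_even (by exact h)).trans ⟨?_, ?_⟩
  · rintro ⟨⟨w, j⟩, ⟨hE, hm⟩, hw⟩
    exact ⟨w, j, hE, hm, hw⟩
  · rintro ⟨w, j, hE, hm, hw⟩
    exact ⟨(w, j), ⟨hE, hm⟩, hw⟩

theorem boundedWin_iff_of_odd {A : Arena} {b : ℕ} {v : A.V} (h : ¬ A.even v) :
    A.BoundedWin b v ↔ ∀ w j, A.E v w →
      ((¬ A.marked v ∧ j = b) ∨ (A.marked v ∧ b = j + 1)) → A.BoundedWin j w :=
  (win_iff_of_odd (by exact h)).trans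
    ⟨fun H w j hE hm => H (w, j) ⟨hE, hm⟩, fun H ⟨w, j⟩ hE => H w j hE.1 hE.2⟩

theorem MarksWithin.evenWins_bounded_iff {A : Arena} {p : ℕ} (h : A.MarksWithin p) (n : ℕ) :
    (A.bounded n).EvenWins ↔ A.BoundedWin n A.init :=
  -- The initial counter value enters only the initial position, so `A.bounded n` and the `A.bounded
  -- 0` of `BoundedWin` have the same moves.
  evenWins_iff_win _ (h.wellFounded_bounded n)

end Arena

/-! ### Subformulas -/

namespace Formula

variable {α : Type}

theorem sub_trans {φ ψ χ : Formula α} (h : φ ∈ ψ.sub) (h' : ψ ∈ χ.sub) : φ ∈ χ.sub := by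
  induction χ <;> simp only [sub, Set.mem_union, Set.mem_singleton_iff] at h' ⊢ <;> grind [sub]

theorem Child.mem_sub {Ψ φ ψ : Formula α} (h : Child Ψ φ ψ) (hφ : φ ∈ Ψ.sub) : ψ ∈ Ψ.sub := by
  cases h with
  | var η X φ h => exact sub_trans (by simp [sub, self_mem_sub]) h
  | _ => exact sub_trans (by simp [sub, self_mem_sub]) hφ

theorem IsModal.of_mem_sub {φ ψ : Formula α} (h : ψ.IsModal) (hφ : φ ∈ ψ.sub) : φ.IsModal := by
  induction ψ <;> simp only [sub, Set.mem_union, Set.mem_singleton_iff] at hφ <;>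
    grind [IsModal]

/-- Evaluation of modal formulas. -/
def Eval (T : Kripke α) : Formula α → T.S → Prop
  | pos P, s => P ∈ T.label s
  | neg P, s => P ∉ T.label s
  | and φ ψ, s => Eval T φ s ∧ Eval T ψ s
  | or φ ψ, s => Eval T φ s ∨ Eval T ψ s
  | dia φ, s => ∃ t, T.E s t ∧ Eval T φ t
  | box φ, s => ∀ t, T.E s t → Eval T φ t
  | top, _ => True
  | _, _ => False

section Eval

variable {T : Kripke α} {s : T.S} {φ ψ : Formula α}

theorem eval_and : (and φ ψ).Eval T s ↔ φ.Eval T s ∧ ψ.Eval T s := Iff.rfl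

theorem eval_or : (or φ ψ).Eval T s ↔ φ.Eval T s ∨ ψ.Eval T s := Iff.rfl

theorem eval_dia : (dia φ).Eval T s ↔ ∃ t, T.E s t ∧ φ.Eval T t := Iff.rfl

theorem eval_box : (box φ).Eval T s ↔ ∀ t, T.E s t → φ.Eval T t := Iff.rfl

theorem eval_top : (top : Formula α).Eval T s ↔ True := Iff.rfl

theorem eval_bot : (bot : Formula α).Eval T s ↔ False := Iff.rfl

end Eval

end Formula

/-! ### The bounded model-checking game -/

section Holds

variable {α : Type}

/-- Even wins the bounded model-checking game from `(s, φ)` with counter value `k`. -/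
def Holds (T : Kripke α) (Ψ : Formula α) (k : ℕ) (s : T.S) (φ : Formula α) : Prop :=
  ∃ h : φ ∈ Ψ.sub, (game T Ψ 0 0).BoundedWin k (s, ⟨φ, h⟩)

variable {T : Kripke α} {Ψ : Formula α} {k : ℕ} {s : T.S} {φ ψ : Formula α}

theorem GameEdge.child {s t : T.S} (h : GameEdge T Ψ (s, φ) (t, ψ)) : Formula.Child Ψ φ ψ := by
  cases h <;> constructor
  assumption

theorem holds_iff_of_even (h : φ ∈ Ψ.sub) (he : EvenOwns T s φ) :
    Holds T Ψ k s φ ↔ ∃ t χ j, GameEdge T Ψ (s, φ) (t, χ) ∧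
      ((¬ φ.Modality ∧ j = k) ∨ (φ.Modality ∧ k = j + 1)) ∧ Holds T Ψ j t χ := by
  constructor
  · rintro ⟨h', hw⟩
    obtain ⟨⟨t, χ, hχ⟩, j, hE, hm, hw⟩ := (Arena.boundedWin_iff_of_even (by exact he)).1 hw
    exact ⟨t, χ, j, hE, hm, hχ, hw⟩
  · rintro ⟨t, χ, j, hE, hm, hχ, hw⟩
    exact ⟨h, (Arena.boundedWin_iff_of_even (by exact he)).2 ⟨(t, ⟨χ, hχ⟩), j, hE, hm, hw⟩⟩

theorem holds_iff_of_odd (h : φ ∈ Ψ.sub) (he : ¬ EvenOwns T s φ) :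
    Holds T Ψ k s φ ↔ ∀ t χ j, GameEdge T Ψ (s, φ) (t, χ) →
      ((¬ φ.Modality ∧ j = k) ∨ (φ.Modality ∧ k = j + 1)) → Holds T Ψ j t χ := by
  constructor
  · rintro ⟨h', hw⟩ t χ j hE hm
    have hχ := hE.child.mem_sub h
    exact ⟨hχ, (Arena.boundedWin_iff_of_odd (by exact he)).1 hw (t, ⟨χ, hχ⟩) j hE hm⟩
  · intro H
    refine ⟨h, (Arena.boundedWin_iff_of_odd (by exact he)).2 ?_⟩
    rintro ⟨t, χ, hχ⟩ j hE hm
    exact (H t χ j hE hm).2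

theorem holds_pos {P : α} (h : .pos P ∈ Ψ.sub) : Holds T Ψ k s (.pos P) ↔ P ∈ T.label s := by
  by_cases hP : P ∈ T.label s
  · simp only [hP, iff_true]
    rw [holds_iff_of_odd h (by simpa [EvenOwns] using hP)]
    rintro t χ j ⟨⟩
  · simp only [hP, iff_false]
    rw [holds_iff_of_even h (by simpa [EvenOwns] using hP)]
    rintro ⟨t, χ, j, ⟨⟩, -⟩

theorem holds_neg {P : α} (h : .neg P ∈ Ψ.sub) : Holds T Ψ k s (.neg P) ↔ P ∉ T.label s := by
  by_cases hP : P ∈ T.label s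
  · simp only [hP, not_true, iff_false]
    rw [holds_iff_of_even h (by simpa [EvenOwns] using hP)]
    rintro ⟨t, χ, j, ⟨⟩, -⟩
  · simp only [hP, not_false_iff, iff_true]
    rw [holds_iff_of_odd h (by simpa [EvenOwns] using hP)]
    rintro t χ j ⟨⟩

theorem holds_top (h : .top ∈ Ψ.sub) : Holds T Ψ k s .top := by
  rw [holds_iff_of_odd h (by simp [EvenOwns])]
  rintro t χ j ⟨⟩

theorem not_holds_bot : ¬ Holds T Ψ k s .bot := by
  intro h
  rw [holds_iff_of_even h.1 (by simp [EvenOwns])] at h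
  obtain ⟨t, χ, j, ⟨⟩, -⟩ := h

theorem holds_and (h : .and φ ψ ∈ Ψ.sub) :
    Holds T Ψ k s (.and φ ψ) ↔ Holds T Ψ k s φ ∧ Holds T Ψ k s ψ := by
  rw [holds_iff_of_odd h (by simp [EvenOwns])]
  simp only [Formula.Modality, not_false_iff, true_and, false_and, or_false]
  constructor
  · exact fun H => ⟨H _ _ _ (.and_left ..) rfl, H _ _ _ (.and_right ..) rfl⟩
  · rintro ⟨h₁, h₂⟩ t χ j ⟨⟩ rfl <;> assumption

theorem holds_or (h : .or φ ψ ∈ Ψ.sub) :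
    Holds T Ψ k s (.or φ ψ) ↔ Holds T Ψ k s φ ∨ Holds T Ψ k s ψ := by
  rw [holds_iff_of_even h (by simp [EvenOwns])]
  simp only [Formula.Modality, not_false_iff, true_and, false_and, or_false]
  constructor
  · rintro ⟨t, χ, j, ⟨⟩, rfl, H⟩
    · exact .inl H
    · exact .inr H
  · rintro (H | H)
    · exact ⟨_, _, _, .or_left .., rfl, H⟩
    · exact ⟨_, _, _, .or_right .., rfl, H⟩

theorem holds_fix {η : Binder} {X : ℕ} (h : .fix η X φ ∈ Ψ.sub) :
    Holds T Ψ k s (.fix η X φ) ↔ Holds T Ψ k s φ := by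
  rw [holds_iff_of_even h (by simp [EvenOwns])]
  simp only [Formula.Modality, not_false_iff, true_and, false_and, or_false]
  constructor
  · rintro ⟨t, χ, j, ⟨⟩, rfl, H⟩
    exact H
  · exact fun H => ⟨_, _, _, .fix .., rfl, H⟩

theorem holds_var {X : ℕ} (h : .var X ∈ Ψ.sub) :
    Holds T Ψ k s (.var X) ↔ ∃ η φ, .fix η X φ ∈ Ψ.sub ∧ Holds T Ψ k s φ := by
  rw [holds_iff_of_even h (by simp [EvenOwns])]
  simp only [Formula.Modality, not_false_iff, true_and, false_and, or_false]
  constructor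
  · rintro ⟨t, χ, j, ⟨⟩, rfl, H⟩
    exact ⟨_, _, ‹_›, H⟩
  · exact fun ⟨_, _, h, H⟩ => ⟨_, _, _, .var _ _ _ _ h, rfl, H⟩

theorem holds_dia (h : .dia φ ∈ Ψ.sub) :
    Holds T Ψ k s (.dia φ) ↔ ∃ j, k = j + 1 ∧ ∃ t, T.E s t ∧ Holds T Ψ j t φ := by
  rw [holds_iff_of_even h (by simp [EvenOwns])]
  simp only [Formula.Modality, not_true, true_and, false_and, false_or]
  constructor
  · rintro ⟨t, χ, j, ⟨⟩, hj, H⟩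
    exact ⟨j, hj, _, ‹_›, H⟩
  · exact fun ⟨j, hj, t, hE, H⟩ => ⟨t, _, j, .dia _ _ _ hE, hj, H⟩

theorem holds_box (h : .box φ ∈ Ψ.sub) :
    Holds T Ψ k s (.box φ) ↔ ∀ j, k = j + 1 → ∀ t, T.E s t → Holds T Ψ j t φ := by
  rw [holds_iff_of_odd h (by simp [EvenOwns])]
  simp only [Formula.Modality, not_true, true_and, false_and, false_or]
  constructor
  · exact fun H j hj t hE => H _ _ _ (.box _ _ _ hE) hj
  · rintro H t χ j ⟨⟩ hj
    exact H j hj _ ‹_›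

end Holds

/-! ### Modal formulas -/

section Modal

variable {α : Type}

/-- Evaluating a modal formula passes through at most `φ.depth` modalities, so a counter that starts
at least this high never stops the play. -/
theorem holds_iff_eval {T : Kripke α} {Ψ φ : Formula α} (hφ : φ.IsModal) (h : φ ∈ Ψ.sub) {k : ℕ}
    (hk : φ.depth ≤ k) (s : T.S) : Holds T Ψ k s φ ↔ φ.Eval T s := by
  induction φ generalizing k s with
  | pos P => exact holds_pos h
  | neg P => exact holds_neg h
  | var X => exact hφ.elim
  | fix => exact hφ.elim
  | bot => exact iff_of_false not_holds_bot id
  | top => exact iff_of_true (holds_top h) trivial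
  | and φ ψ ih₁ ih₂ =>
    have hk := max_le_iff.1 hk
    rw [holds_and h, ih₁ hφ.1 ((Formula.Child.and_left _ _).mem_sub h) hk.1,
      ih₂ hφ.2 ((Formula.Child.and_right _ _).mem_sub h) hk.2, Formula.Eval]
  | or φ ψ ih₁ ih₂ =>
    have hk := max_le_iff.1 hk
    rw [holds_or h, ih₁ hφ.1 ((Formula.Child.or_left _ _).mem_sub h) hk.1,
      ih₂ hφ.2 ((Formula.Child.or_right _ _).mem_sub h) hk.2, Formula.Eval]
  | dia φ ih =>
    obtain ⟨j, rfl⟩ : ∃ j, k = j + 1 := ⟨k - 1, by simp [Formula.depth] at hk; omega⟩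
    have hk : φ.depth ≤ j := by simpa [Formula.depth] using hk
    simp [holds_dia h, ih hφ ((Formula.Child.dia _).mem_sub h) hk, Formula.Eval]
  | box φ ih =>
    obtain ⟨j, rfl⟩ : ∃ j, k = j + 1 := ⟨k - 1, by simp [Formula.depth] at hk; omega⟩
    have hk : φ.depth ≤ j := by simpa [Formula.depth] using hk
    simp [holds_box h, ih hφ ((Formula.Child.box _).mem_sub h) hk, Formula.Eval]

theorem wellFounded_game_of_isModal {Φ : Formula α} (hΦ : Φ.IsModal) (T : Kripke α) (l : ℕ)
    (Ω : ℕ → ℕ) : WellFounded (flip (game T Φ l Ω).E) := by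
  refine Subrelation.wf (r := InvImage (· < ·) fun x : (game T Φ l Ω).V => sizeOf x.2.1) ?_
    (InvImage.wf _ wellFounded_lt)
  rintro ⟨t, ψ, hψ⟩ ⟨s, φ, hφ⟩ (h : GameEdge T Φ (s, φ) (t, ψ))
  have hm : φ.IsModal := hΦ.of_mem_sub hφ
  change sizeOf ψ < sizeOf φ
  cases h
  case var => exact hm.elim
  all_goals simp +arith

/-- The unbounded game is bisimilar to the bounded one along the pairs whose counter is at least the
depth of the current formula. Priorities play no role. -/
theorem evenWins_game_iff_eval {Φ : Formula α} (hΦ : Φ.IsModal) (T : Kripke α) (l : ℕ)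
    (Ω : ℕ → ℕ) : (game T Φ l Ω).EvenWins ↔ Φ.Eval T T.root := by
  rw [Arena.evenWins_iff_win _ (wellFounded_game_of_isModal hΦ T l Ω),
    ← holds_iff_eval hΦ Φ.self_mem_sub le_rfl, Holds, exists_prop_of_true Φ.self_mem_sub]
  refine win_iff_of_bisim (fun x y => y.1 = x ∧ x.2.1.depth ≤ y.2) ?_ ?_ ?_ ⟨rfl, le_rfl⟩
  · rintro x ⟨y, k⟩ ⟨rfl, -⟩
    rfl
  · rintro ⟨s, φ, hφ⟩ ⟨_, k⟩ ⟨t, ψ, hψ⟩ ⟨rfl, hk⟩ (h : GameEdge T Φ (s, φ) (t, ψ))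
    have hm : φ.IsModal := hΦ.of_mem_sub hφ
    change φ.depth ≤ k at hk
    suffices H : ∃ j, ψ.depth ≤ j ∧
        ((¬ φ.Modality ∧ j = k) ∨ (φ.Modality ∧ k = j + 1)) by
      obtain ⟨j, hj, hmod⟩ := H
      exact ⟨((t, ⟨ψ, hψ⟩), j), ⟨h, hmod⟩, rfl, hj⟩
    cases h <;> simp only [Formula.depth, max_le_iff] at hk
    case var => exact hm.elim
    case dia => exact ⟨k - 1, by omega, .inr ⟨trivial, by omega⟩⟩
    case box => exact ⟨k - 1, by omega, .inr ⟨trivial, by omega⟩⟩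
    all_goals exact ⟨k, by omega, .inl ⟨id, rfl⟩⟩
  · rintro ⟨s, φ, hφ⟩ ⟨_, k⟩ ⟨⟨t, ψ, hψ⟩, j⟩ ⟨rfl, hk⟩ ⟨h, hmod⟩
    refine ⟨(t, ⟨ψ, hψ⟩), h, rfl, ?_⟩
    have hm : φ.IsModal := hΦ.of_mem_sub hφ
    change GameEdge T Φ (s, φ) (t, ψ) at h
    change φ.depth ≤ k at hk
    change (¬ φ.Modality ∧ j = k) ∨ (φ.Modality ∧ k = j + 1) at hmod
    change ψ.depth ≤ j
    cases h <;> simp only [Formula.depth, max_le_iff, Formula.Modality] at hk hmod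
    case var => exact hm.elim
    all_goals simp at hmod; omega

theorem orderPreserving_of_isModal {Φ : Formula α} (hΦ : Φ.IsModal) :
    Φ.OrderPreserving 0 0 0 := by
  constructor
  · exact zero_le_one
  · exact le_rfl
  all_goals intros
  all_goals
    have h : (Formula.fix _ _ _).IsModal := hΦ.of_mem_sub ‹_ ∈ Φ.sub›
    exact h.elim

theorem sat_iff_eval {Φ : Formula α} (hΦ : Φ.IsModal) (T : Kripke α) :
    Sat T Φ ↔ Φ.Eval T T.root := by
  constructor
  · rintro ⟨l, q, Ω, -, h⟩
    exact (evenWins_game_iff_eval hΦ T l Ω).1 h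
  · intro h
    exact ⟨0, 0, 0, orderPreserving_of_isModal hΦ, (evenWins_game_iff_eval hΦ T 0 0).2 h⟩

end Modal

/-! ### The formulas `boundedFormula` -/

theorem eval_bigOr {α : Type} {T : Kripke α} {s : T.S} (L : List (Formula α)) :
    (bigOr L).Eval T s ↔ ∃ φ ∈ L, φ.Eval T s := by
  induction L with
  | nil => simp [bigOr, Formula.Eval]
  | cons φ L ih => simp [bigOr, Formula.Eval, ih]

theorem isModal_bigOr {α : Type} (L : List (Formula α)) (h : ∀ φ ∈ L, φ.IsModal) :
    (bigOr L).IsModal := by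
  induction L with
  | nil => trivial
  | cons φ L ih => exact ⟨h _ (by simp), ih fun ψ hψ => h _ (by simp [hψ])⟩

theorem isModal_ownedByEven (l q : ℕ) : (ownedByEven l q).IsModal :=
  isModal_bigOr _ fun φ hφ => by
    obtain ⟨i, -, rfl⟩ := List.mem_map.1 hφ
    trivial

theorem isModal_ownedByOdd (l q : ℕ) : (ownedByOdd l q).IsModal :=
  isModal_bigOr _ fun φ hφ => by
    obtain ⟨i, -, rfl⟩ := List.mem_map.1 hφ
    trivial

theorem isModal_boundedFormula (l q p a b : ℕ) : (boundedFormula l q p a b).IsModal := by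
  induction b generalizing a with
  | zero =>
    induction a with
    | zero => rw [boundedFormula]; trivial
    | succ a ih =>
      rw [boundedFormula]
      simp [Formula.IsModal, isModal_ownedByEven, isModal_ownedByOdd, ih]
  | succ b ihb =>
    induction a with
    | zero => rw [boundedFormula]; trivial
    | succ a ih =>
      rw [boundedFormula]
      simp [Formula.IsModal, isModal_ownedByEven, isModal_ownedByOdd, ih, ihb]

section BoundedFormula

variable {A : Arena} {l q p : ℕ}

/-- The position at the end of a path of the encoded arena. -/
def Arena.position (A : Arena) (x : A.toTree.S) : A.V := x.1

theorem Arena.edge_of_toTree_edge {x y : A.toTree.S} (h : A.toTree.E x y) :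
    A.E (A.position x) (A.position y) :=
  h.1

theorem Arena.exists_toTree_edge (x : A.toTree.S) {w : A.V} (h : A.E (A.position x) w) :
    ∃ y, A.toTree.E x y ∧ A.position y = w :=
  ⟨⟨w, x.2.snoc h⟩, ⟨h, rfl⟩, rfl⟩

theorem eval_marked (x : A.toTree.S) :
    (Formula.pos GameProp.M).Eval A.toTree x ↔ A.marked (A.position x) :=
  Iff.rfl

theorem eval_not_marked (x : A.toTree.S) :
    (Formula.neg GameProp.M).Eval A.toTree x ↔ ¬ A.marked (A.position x) :=
  Iff.rfl

theorem eval_ownedByEven (hA : ∀ v, l ≤ A.prio v ∧ A.prio v ≤ q) (x : A.toTree.S) :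
    (ownedByEven l q).Eval A.toTree x ↔ A.even (A.position x) := by
  rw [ownedByEven, eval_bigOr]
  constructor
  · simp only [List.mem_map]
    rintro ⟨_, ⟨i, -, rfl⟩, h⟩
    exact h.1
  · intro h
    refine ⟨_, List.mem_map.2 ⟨A.prio (A.position x), ?_, rfl⟩, h, rfl⟩
    have := hA (A.position x)
    rw [List.mem_range'_1]
    omega

theorem eval_ownedByOdd (hA : ∀ v, l ≤ A.prio v ∧ A.prio v ≤ q) (x : A.toTree.S) :
    (ownedByOdd l q).Eval A.toTree x ↔ ¬ A.even (A.position x) := by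
  rw [ownedByOdd, eval_bigOr]
  constructor
  · simp only [List.mem_map]
    rintro ⟨_, ⟨i, -, rfl⟩, h⟩
    exact h.1
  · intro h
    refine ⟨_, List.mem_map.2 ⟨A.prio (A.position x), ?_, rfl⟩, h, rfl⟩
    have := hA (A.position x)
    rw [List.mem_range'_1]
    omega

/-- Successors in the unfolding correspond to moves of the arena. Hence a property of paths that
depends only on their last position can be evaluated in the arena itself. -/
theorem eval_dia_iff {φ : Formula GameProp} {P : A.V → Prop} {x : A.toTree.S}
    (h : ∀ y, A.toTree.E x y → (φ.Eval A.toTree y ↔ P (A.position y))) :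
    (Formula.dia φ).Eval A.toTree x ↔ ∃ w, A.E (A.position x) w ∧ P w := by
  constructor
  · rintro ⟨y, hE, hy⟩
    exact ⟨_, Arena.edge_of_toTree_edge hE, (h y hE).1 hy⟩
  · rintro ⟨w, hE, hw⟩
    obtain ⟨y, hxy, rfl⟩ := Arena.exists_toTree_edge x hE
    exact ⟨y, hxy, (h y hxy).2 hw⟩

theorem eval_box_iff {φ : Formula GameProp} {P : A.V → Prop} {x : A.toTree.S}
    (h : ∀ y, A.toTree.E x y → (φ.Eval A.toTree y ↔ P (A.position y))) :
    (Formula.box φ).Eval A.toTree x ↔ ∀ w, A.E (A.position x) w → P w := by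
  constructor
  · intro H w hE
    obtain ⟨y, hxy, rfl⟩ := Arena.exists_toTree_edge x hE
    exact (h y hxy).1 (H y hxy)
  · exact fun H y hE => (h y hE).2 (H _ (Arena.edge_of_toTree_edge hE))

/-- The induction on `b` and then `a` follows the recursion of the formula. The value $B_{0,b}=\bot$
is never reached: `a` bounds the number of positions up to and including the next mark, and the
current position already counts as one. -/
theorem eval_boundedFormula (hA : ∀ v, l ≤ A.prio v ∧ A.prio v ≤ q) (hp : A.MarksWithin p)
    (b a : ℕ) (x : A.toTree.S) (hx : A.MarksWithinFrom a (A.position x)) :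
    (boundedFormula l q p a b).Eval A.toTree x ↔ A.BoundedWin b (A.position x) := by
  induction b generalizing a x with
  | zero =>
    induction a generalizing x with
    | zero => exact absurd hx (A.not_marksWithinFrom_zero _)
    | succ a ih =>
      rw [boundedFormula]
      simp only [Formula.eval_and, Formula.eval_or, Formula.eval_top, Formula.eval_bot,
        eval_marked, eval_not_marked, eval_ownedByEven hA, eval_ownedByOdd hA]
      by_cases hm : A.marked (A.position x)
      · by_cases he : A.even (A.position x)
        · simp [Arena.boundedWin_iff_of_even he, hm, he]
        · simp [Arena.boundedWin_iff_of_odd he, hm, he]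
      · have IH : ∀ y, A.toTree.E x y → _ := fun y hE =>
          ih y (hx.step hm (Arena.edge_of_toTree_edge hE))
        rw [eval_dia_iff IH, eval_box_iff IH]
        by_cases he : A.even (A.position x)
        · simp [Arena.boundedWin_iff_of_even he, hm, he]
        · simp [Arena.boundedWin_iff_of_odd he, hm, he]
  | succ b ihb =>
    induction a generalizing x with
    | zero => exact absurd hx (A.not_marksWithinFrom_zero _)
    | succ a ih =>
      have IHb : ∀ y, A.toTree.E x y → _ := fun y _ => ihb p y (hp.from _)
      rw [boundedFormula]
      simp only [Formula.eval_and, Formula.eval_or,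
        eval_marked, eval_not_marked, eval_ownedByEven hA, eval_ownedByOdd hA]
      rw [eval_dia_iff IHb, eval_box_iff IHb]
      by_cases hm : A.marked (A.position x)
      · by_cases he : A.even (A.position x)
        · simp [Arena.boundedWin_iff_of_even he, hm, he]
        · simp [Arena.boundedWin_iff_of_odd he, hm, he]
      · have IH : ∀ y, A.toTree.E x y → _ := fun y hE =>
          ih y (hx.step hm (Arena.edge_of_toTree_edge hE))
        rw [eval_dia_iff IH, eval_box_iff IH]
        by_cases he : A.even (A.position x)
        · simp [Arena.boundedWin_iff_of_even he, hm, he]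
        · simp [Arena.boundedWin_iff_of_odd he, hm, he]

theorem sat_boundedFormula (hA : ∀ v, l ≤ A.prio v ∧ A.prio v ≤ q) (hp : A.MarksWithin p)
    (n : ℕ) : Sat A.toTree (boundedFormula l q p p n) ↔ (A.bounded n).EvenWins := by
  rw [sat_iff_eval (isModal_boundedFormula l q p p n),
    eval_boundedFormula hA hp n p _ (hp.from _), hp.evenWins_bounded_iff n]
  rfl

end BoundedFormula

/-! ### Truncated trees -/

section Truncate

variable {α : Type} {T : Kripke α}

theorem Kripke.IsRegularTree.atDepth_unique (hT : T.IsRegularTree) {j k : ℕ} {s : T.S}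
    (hj : T.AtDepth j s) (hk : T.AtDepth k s) : j = k := by
  induction j generalizing k s with
  | zero =>
    cases k with
    | zero => rfl
    | succ k =>
      obtain rfl : s = T.root := hj
      obtain ⟨t, -, h⟩ := hk
      exact absurd h (hT.root_min t)
  | succ j ih =>
    obtain ⟨t, ht, hE⟩ := hj
    cases k with
    | zero =>
      obtain rfl : s = T.root := hk
      exact absurd hE (hT.root_min t)
    | succ k =>
      obtain ⟨u, hu, hE'⟩ := hk
      obtain rfl := hT.pred_unique _ _ _ hE hE'
      rw [ih ht hu]

theorem Kripke.finite_atDepth (hT : ∀ s, {t | T.E s t}.Finite) (k : ℕ) :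
    {s | T.AtDepth k s}.Finite := by
  induction k with
  | zero => exact Set.finite_singleton T.root
  | succ k ih =>
    refine (ih.biUnion fun s _ => hT s).subset ?_
    rintro t ⟨s, hs, hE⟩
    exact Set.mem_biUnion hs hE

theorem Kripke.isRegularTree_of_finite [Finite T.S] (h₁ : ∀ s, ReflTransGen T.E T.root s)
    (h₂ : ∀ s, ¬ T.E s T.root) (h₃ : ∀ s t u, T.E s u → T.E t u → s = t)
    (h₄ : {a | ∃ s, a ∈ T.label s}.Finite) : T.IsRegularTree where
  reach := h₁
  root_min := h₂
  pred_unique := h₃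
  finite_branching s := Set.toFinite _
  finite_label := h₄
  regular := by
    -- Distinct states get distinct colours, so only the identity isomorphism is needed.
    obtain ⟨n, ⟨e⟩⟩ := Finite.exists_equiv_fin T.S
    refine ⟨n, e, fun s t h => ?_⟩
    obtain rfl := e.injective h
    exact ⟨Equiv.refl _, rfl, fun _ _ => Iff.rfl, fun _ => rfl⟩

theorem Kripke.IsRegularTree.finite_truncate (hT : T.IsRegularTree) (n : ℕ) :
    Finite (T.truncate n).S := by
  refine Set.Finite.to_subtype (s := {s | ∃ k ≤ n, T.AtDepth k s}) ?_
  refine ((Set.finite_le_nat n).biUnion fun k _ => T.finite_atDepth hT.finite_branching k).subset ?_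
  rintro s ⟨k, hk, hs⟩
  exact Set.mem_biUnion hk hs

theorem Kripke.IsRegularTree.truncate (hT : T.IsRegularTree) (n : ℕ) :
    (T.truncate n).IsRegularTree := by
  have := hT.finite_truncate n
  refine isRegularTree_of_finite ?_ ?_ ?_ ?_
  · suffices H : ∀ k (hk : k ≤ n) s (hs : T.AtDepth k s),
        ReflTransGen (T.truncate n).E (T.truncate n).root ⟨s, k, hk, hs⟩ by
      rintro ⟨s, k, hk, hs⟩
      exact H k hk s hs
    intro k
    induction k with
    | zero =>
      rintro hk s rfl
      exact .refl
    | succ k ih =>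
      rintro hk s ⟨t, ht, hE⟩
      exact (ih (by omega) t ht).tail hE
  · exact fun s => hT.root_min s.1
  · exact fun s t u h h' => Subtype.ext (hT.pred_unique _ _ _ h h')
  · exact hT.finite_label.subset fun a ⟨s, hs⟩ => ⟨s.1, hs⟩

/-- Attaching the counter value `n - depth` to a state turns moves of the truncated game into moves
of the bounded game, which is well-founded. -/
theorem game_marksWithin_wellFounded_truncate (hT : T.IsRegularTree) {Ψ : Formula α} {l : ℕ}
    {Ω : ℕ → ℕ} {p : ℕ} (hp : (game T Ψ l Ω).MarksWithin p) (n : ℕ) :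
    WellFounded (flip (game (T.truncate n) Ψ l Ω).E) := by
  choose d hd using fun s : (T.truncate n).S => s.2
  refine Subrelation.wf (r := InvImage (flip ((game T Ψ l Ω).bounded n).E)
    fun x : (game (T.truncate n) Ψ l Ω).V => ((x.1.1, x.2), n - d x.1)) ?_
    (InvImage.wf _ (hp.wellFounded_bounded n))
  rintro ⟨t, ψ, hψ⟩ ⟨s, φ, hφ⟩ (h : GameEdge (T.truncate n) Ψ (s, φ) (t, ψ))
  have hsucc : (T.truncate n).E s t → n - d s = n - d t + 1 := by
    intro hE
    have := hT.atDepth_unique (hd t).2 (k := d s + 1) ⟨_, (hd s).2, hE⟩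
    have := (hd t).1
    omega
  change GameEdge T Ψ (s.1, φ) (t.1, ψ) ∧
    ((¬ φ.Modality ∧ n - d t = n - d s) ∨ (φ.Modality ∧ n - d s = n - d t + 1))
  cases h
  case dia h => exact ⟨.dia _ _ _ h, .inr ⟨trivial, hsucc h⟩⟩
  case box h => exact ⟨.box _ _ _ h, .inr ⟨trivial, hsucc h⟩⟩
  case var h => exact ⟨.var _ _ _ _ h, .inl ⟨id, rfl⟩⟩
  all_goals exact ⟨by constructor, .inl ⟨id, rfl⟩⟩

/-- The bisimulation keeps depth plus counter equal to `n`. Each modal move changes the two by one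
in opposite directions, and both games block it at the same moment, when the depth is `n` and the
counter `0`. -/
theorem evenWins_truncate_iff_holds (hT : T.IsRegularTree) {Ψ : Formula α} {l : ℕ}
    {Ω : ℕ → ℕ} {p : ℕ} (hp : (game T Ψ l Ω).MarksWithin p) (n : ℕ) :
    (game (T.truncate n) Ψ l Ω).EvenWins ↔ Holds T Ψ n T.root Ψ := by
  rw [Arena.evenWins_iff_win _ (game_marksWithin_wellFounded_truncate hT hp n), Holds,
    exists_prop_of_true Ψ.self_mem_sub]
  refine win_iff_of_bisim (fun x y => y.1 = (x.1.1, x.2) ∧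
    ∃ d, T.AtDepth d x.1.1 ∧ d + y.2 = n) ?_ ?_ ?_ ?_
  rotate_left 3
  · exact ⟨rfl, 0, (rfl : T.root = T.root), Nat.zero_add n⟩
  · rintro ⟨s, φ, hφ⟩ ⟨y, k⟩ ⟨rfl, -⟩
    cases φ <;> rfl
  · rintro ⟨s, φ, hφ⟩ ⟨_, k⟩ ⟨t, ψ, hψ⟩ ⟨rfl, d, hd, hk⟩
      (h : GameEdge (T.truncate n) Ψ (s, φ) (t, ψ))
    change d + k = n at hk
    change T.AtDepth d s.1 at hd
    have hsucc : (T.truncate n).E s t → T.AtDepth (d + 1) t.1 ∧ d + 1 ≤ n := by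
      intro hE
      -- Membership in the fragment gives `t` some depth at most `n`, and uniqueness of depths
      -- identifies it with `d + 1`. So the counter is positive here.
      obtain ⟨k, hk, hk'⟩ := t.2
      have h' : T.AtDepth (d + 1) t.1 := ⟨_, hd, hE⟩
      have := hT.atDepth_unique hk' h'
      exact ⟨h', by omega⟩
    suffices H : GameEdge T Ψ (s.1, φ) (t.1, ψ) ∧ ∃ j,
        ((¬ φ.Modality ∧ j = k) ∨ (φ.Modality ∧ k = j + 1)) ∧
          ∃ d, T.AtDepth d t.1 ∧ d + j = n by
      obtain ⟨hE, j, hj, hd⟩ := H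
      exact ⟨((t.1, ⟨ψ, hψ⟩), j), ⟨hE, hj⟩, rfl, hd⟩
    cases h
    case dia h =>
      obtain ⟨h₁, h₂⟩ := hsucc h
      exact ⟨.dia _ _ _ h, k - 1, .inr ⟨trivial, by omega⟩, _, h₁, by omega⟩
    case box h =>
      obtain ⟨h₁, h₂⟩ := hsucc h
      exact ⟨.box _ _ _ h, k - 1, .inr ⟨trivial, by omega⟩, _, h₁, by omega⟩
    case var h => exact ⟨.var _ _ _ _ h, k, .inl ⟨id, rfl⟩, d, hd, hk⟩
    all_goals exact ⟨by constructor, k, .inl ⟨id, rfl⟩, d, hd, hk⟩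
  · rintro ⟨s, φ, hφ⟩ ⟨_, k⟩ ⟨⟨t, ψ, hψ⟩, j⟩ ⟨rfl, d, hd, hk⟩ ⟨h, hmod⟩
    change d + k = n at hk
    change T.AtDepth d s.1 at hd
    change GameEdge T Ψ (s.1, φ) (t, ψ) at h
    change (¬ φ.Modality ∧ j = k) ∨ (φ.Modality ∧ k = j + 1) at hmod
    suffices H : ∃ t' : (T.truncate n).S, t'.1 = t ∧ GameEdge (T.truncate n) Ψ (s, φ) (t', ψ) ∧
        ∃ d, T.AtDepth d t ∧ d + j = n by
      obtain ⟨t', rfl, hE, hd⟩ := H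
      exact ⟨(t', ⟨ψ, hψ⟩), hE, rfl, hd⟩
    have hstay : ∀ t' : (T.truncate n).S, GameEdge (T.truncate n) Ψ (s, φ) (t', ψ) → j = k →
        t'.1 = s.1 → ∃ t' : (T.truncate n).S, t'.1 = s.1 ∧
        GameEdge (T.truncate n) Ψ (s, φ) (t', ψ) ∧ ∃ d, T.AtDepth d s.1 ∧ d + j = n :=
      fun t' hE hj h => ⟨t', h, hE, d, hd, by omega⟩
    cases h <;> simp only [Formula.Modality, not_true, not_false_iff, true_and, false_and,
      or_false, false_or] at hmod
    case dia h =>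
      have h' : T.AtDepth (d + 1) t := ⟨_, hd, h⟩
      exact ⟨⟨t, d + 1, by omega, h'⟩, rfl, .dia _ _ _ h, d + 1, h', by omega⟩
    case box h =>
      have h' : T.AtDepth (d + 1) t := ⟨_, hd, h⟩
      exact ⟨⟨t, d + 1, by omega, h'⟩, rfl, .box _ _ _ h, d + 1, h', by omega⟩
    case var h => exact hstay s (.var _ _ _ _ h) hmod rfl
    all_goals exact hstay s (by constructor) hmod rfl

theorem evenWins_bounded_iff_holds {Ψ : Formula α} {l : ℕ}
    {Ω : ℕ → ℕ} {p : ℕ} (hp : (game T Ψ l Ω).MarksWithin p) (n : ℕ) :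
    ((game T Ψ l Ω).bounded n).EvenWins ↔ Holds T Ψ n T.root Ψ := by
  rw [hp.evenWins_bounded_iff n, Holds, exists_prop_of_true Ψ.self_mem_sub]
  rfl

end Truncate

namespace Formula

/-! ### Codes and ranks of subformulas -/

section Code

variable {α : Type} (c : α → ℕ)

theorem code_lt_pair_pair_left {t a b : ℕ} (ht : 0 < t) : a < Nat.pair t (Nat.pair a b) := by
  have h₁ := Nat.add_le_pair t (Nat.pair a b)
  have h₂ := Nat.add_le_pair a b
  omega

theorem code_lt_pair_pair_right {t a b : ℕ} (ht : 0 < t) : b < Nat.pair t (Nat.pair a b) := by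
  have h₁ := Nat.add_le_pair t (Nat.pair a b)
  have h₂ := Nat.add_le_pair a b
  omega

theorem code_lt_pair {t a : ℕ} (ht : 0 < t) : a < Nat.pair t a := by
  have h₁ := Nat.add_le_pair t a
  omega

theorem code_lt_fix (η : Binder) (X : ℕ) (φ : Formula α) : φ.code c < (fix η X φ).code c := by
  cases η <;> exact code_lt_pair_pair_right (by norm_num)

theorem code_lt_of_child {Ψ φ ψ : Formula α} (h : Child Ψ φ ψ) (hφ : ∀ X, φ ≠ var X) :
    ψ.code c < φ.code c := by
  cases h
  case var => exact absurd rfl (hφ _)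
  case fix => exact code_lt_fix ..
  case and_left => exact code_lt_pair_pair_left (by norm_num)
  case and_right => exact code_lt_pair_pair_right (by norm_num)
  case or_left => exact code_lt_pair_pair_left (by norm_num)
  case or_right => exact code_lt_pair_pair_right (by norm_num)
  case dia => exact code_lt_pair (by norm_num)
  case box => exact code_lt_pair (by norm_num)

theorem code_le_of_mem_sub {φ Ψ : Formula α} (h : φ ∈ Ψ.sub) : φ.code c ≤ Ψ.code c := by
  induction Ψ <;> simp only [sub, Set.mem_union, Set.mem_singleton_iff] at h
  case and φ₁ φ₂ ih₁ ih₂ =>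
    rcases h with rfl | h | h
    · rfl
    · exact (ih₁ h).trans (code_lt_of_child c (.and_left (Ψ := φ) φ₁ φ₂) (by simp)).le
    · exact (ih₂ h).trans (code_lt_of_child c (.and_right (Ψ := φ) φ₁ φ₂) (by simp)).le
  case or φ₁ φ₂ ih₁ ih₂ =>
    rcases h with rfl | h | h
    · rfl
    · exact (ih₁ h).trans (code_lt_of_child c (.or_left (Ψ := φ) φ₁ φ₂) (by simp)).le
    · exact (ih₂ h).trans (code_lt_of_child c (.or_right (Ψ := φ) φ₁ φ₂) (by simp)).le
  case dia χ ih =>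
    rcases h with rfl | h
    · rfl
    · exact (ih h).trans (code_lt_of_child c (.dia (Ψ := φ) χ) (by simp)).le
  case box χ ih =>
    rcases h with rfl | h
    · rfl
    · exact (ih h).trans (code_lt_of_child c (.box (Ψ := φ) χ) (by simp)).le
  case fix η X χ ih =>
    rcases h with rfl | h
    · rfl
    · exact (ih h).trans (code_lt_fix ..).le
  all_goals exact (congrArg _ h).le

end Code

variable {α : Type} {Ψ : Formula α}

theorem exists_binding_of_free {φ Ψ : Formula α} {Y : ℕ} (h : φ ∈ Ψ.sub) (hY : Y ∈ φ.free) :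
    Y ∈ Ψ.free ∨ ∃ η ψ, fix η Y ψ ∈ Ψ.sub ∧ φ ∈ ψ.sub := by
  induction Ψ <;> simp only [sub, Set.mem_union, Set.mem_singleton_iff] at h
  case fix η X χ ih =>
    rcases h with rfl | h
    · exact .inl hY
    · rcases ih h with h' | ⟨η', ψ, h', h''⟩
      · by_cases hX : Y = X
        · subst hX
          exact .inr ⟨η, χ, self_mem_sub _, h⟩
        · exact .inl ⟨h', hX⟩
      · exact .inr ⟨η', ψ, .inr h', h''⟩
  all_goals grind [free, sub]

theorem IsSentence.exists_binding (hΨ : Ψ.IsSentence) {φ : Formula α} {Y : ℕ} (h : φ ∈ Ψ.sub)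
    (hY : Y ∈ φ.free) : ∃ η ψ, fix η Y ψ ∈ Ψ.sub ∧ φ ∈ ψ.sub := by
  rcases exists_binding_of_free h hY with h | h
  · rw [hΨ] at h
    exact h.elim
  · exact h

/-- In well-named sentences, the variables that are free in a binding formula are bound by formulas
of larger code. -/
theorem IsSentence.code_lt_code (hΨ : Ψ.IsSentence) (hn : Ψ.WellNamed) (c : α → ℕ)
    {η η' : Binder} {X Y : ℕ} {φ ψ : Formula α} (hX : fix η X φ ∈ Ψ.sub)
    (hY : fix η' Y ψ ∈ Ψ.sub) (h : Y ∈ φ.free) (hXY : Y ≠ X) : φ.code c < ψ.code c := by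
  obtain ⟨η'', ψ', h', hs⟩ := hΨ.exists_binding (Y := Y) hX ⟨h, hXY⟩
  obtain ⟨-, rfl⟩ := hn _ _ _ _ _ hY h'
  exact (code_lt_fix c η X φ).trans_le (code_le_of_mem_sub c hs)

/-- The variables with an occurrence that is not in the scope of a modality. -/
def unguarded : Formula α → Set ℕ
  | var X => {X}
  | and φ ψ => unguarded φ ∪ unguarded ψ
  | or φ ψ => unguarded φ ∪ unguarded ψ
  | fix _ _ φ => unguarded φ
  | _ => ∅

/-- The set `unguarded` ignores binders, but in a guarded formula a binder never captures an
occurrence outside the scope of modalities, so such occurrences stay free. -/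
theorem free_of_unguarded {φ : Formula α} (h : φ.Guarded) {Y : ℕ}
    (hY : Y ∈ φ.unguarded) : Y ∈ φ.free ∧ ¬ GuardedIn Y φ := by
  induction φ with
  | var X => exact ⟨hY, fun h => h hY.symm⟩
  | and φ ψ ih₁ ih₂ =>
    rcases hY with hY | hY
    · obtain ⟨h₁, h₂⟩ := ih₁ (fun η X χ hχ => h η X χ (.inr (.inl hχ))) hY
      exact ⟨.inl h₁, fun h => h₂ h.1⟩
    · obtain ⟨h₁, h₂⟩ := ih₂ (fun η X χ hχ => h η X χ (.inr (.inr hχ))) hY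
      exact ⟨.inr h₁, fun h => h₂ h.2⟩
  | or φ ψ ih₁ ih₂ =>
    rcases hY with hY | hY
    · obtain ⟨h₁, h₂⟩ := ih₁ (fun η X χ hχ => h η X χ (.inr (.inl hχ))) hY
      exact ⟨.inl h₁, fun h => h₂ h.1⟩
    · obtain ⟨h₁, h₂⟩ := ih₂ (fun η X χ hχ => h η X χ (.inr (.inr hχ))) hY
      exact ⟨.inr h₁, fun h => h₂ h.2⟩
  | fix η X φ ih =>
    obtain ⟨h₁, h₂⟩ := ih (fun η X χ hχ => h η X χ (.inr hχ)) hY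
    have hXY : Y ≠ X := by
      rintro rfl
      exact h₂ (h η Y φ (self_mem_sub _))
    exact ⟨⟨h₁, hXY⟩, fun h => h.elim (fun h => hXY h.symm) h₂⟩
  | _ => exact hY.elim

/-- The codes of the formulas that bind the unguarded variables of a subformula `φ` of `Ψ`. -/
def bindingCodes (c : α → ℕ) (Ψ φ : Formula α) : Set ℕ :=
  insert (Ψ.code c) {n | ∃ Y ∈ φ.unguarded, ∃ η ψ, fix η Y ψ ∈ Ψ.sub ∧ n = ψ.code c}

/-- A rank that decreases along the edges of the parse tree that do not start at a modality. -/
noncomputable def rank (c : α → ℕ) (Ψ φ : Formula α) : ℕ :=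
  (Ψ.code c - sInf (bindingCodes c Ψ φ)) * (Ψ.code c + 1) + φ.code c

theorem sInf_bindingCodes_le (c : α → ℕ) (Ψ φ : Formula α) :
    sInf (bindingCodes c Ψ φ) ≤ Ψ.code c :=
  Nat.sInf_le (Set.mem_insert _ _)

/-- The rank is a two-digit number in base `Ψ.code c + 1`, and both digits are at most `Ψ.code c`.
-/
theorem rank_lt {c : α → ℕ} {φ : Formula α} (h : φ ∈ Ψ.sub) :
    rank c Ψ φ < (Ψ.code c + 1) ^ 2 := by
  have h₁ := code_le_of_mem_sub c h
  have h₂ := Nat.mul_le_mul_right (Ψ.code c + 1)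
    (Nat.sub_le (Ψ.code c) (sInf (bindingCodes c Ψ φ)))
  rw [rank]
  nlinarith

theorem rank_lt_of_code_lt {c : α → ℕ} {φ ψ : Formula α} (h : ψ.code c < φ.code c)
    (hu : ψ.unguarded ⊆ φ.unguarded) : rank c Ψ ψ < rank c Ψ φ := by
  have h₁ : bindingCodes c Ψ ψ ⊆ bindingCodes c Ψ φ :=
    Set.insert_subset_insert fun n ⟨Y, hY, h⟩ => ⟨Y, hu hY, h⟩
  have h₂ : sInf (bindingCodes c Ψ φ) ≤ sInf (bindingCodes c Ψ ψ) :=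
    Nat.sInf_le (h₁ (Nat.sInf_mem ⟨_, Set.mem_insert _ _⟩))
  have h₃ := Nat.mul_le_mul_right (Ψ.code c + 1) (Nat.sub_le_sub_left h₂ (Ψ.code c))
  rw [rank, rank]
  omega

/-- Away from variables, the code drops and no unguarded variable appears, so the leading digit does
not grow. At a variable `X` the code may grow, but the unguarded variables of the body `ψ` are free
in it and differ from `X` by guardedness. They are bound further out, by bodies of larger code, so
the infimum of `bindingCodes` rises above `ψ.code c` and the leading digit drops. -/
theorem rank_lt_of_child (c : α → ℕ) (hs : Ψ.IsSentence) (hn : Ψ.WellNamed) (hg : Ψ.Guarded)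
    {φ ψ : Formula α} (hφ : φ ∈ Ψ.sub) (hm : ¬ φ.Modality) (h : Child Ψ φ ψ) :
    rank c Ψ ψ < rank c Ψ φ := by
  cases h
  case var η X hX =>
    have h₁ : sInf (bindingCodes c Ψ (var X)) ≤ ψ.code c :=
      Nat.sInf_le (.inr ⟨X, rfl, η, ψ, hX, rfl⟩)
    have h₂ : ψ.code c < sInf (bindingCodes c Ψ ψ) := by
      obtain h | ⟨Y, hY, η', χ, hχ, h⟩ :=
        Nat.sInf_mem (s := bindingCodes c Ψ ψ) ⟨_, Set.mem_insert _ _⟩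
      · rw [h]
        exact (code_lt_fix c η X ψ).trans_le (code_le_of_mem_sub c hX)
      · rw [h]
        obtain ⟨h₁, h₂⟩ := free_of_unguarded
          (fun η' X' χ' h' => hg η' X' χ' (sub_trans h' ((Child.fix η X ψ).mem_sub hX))) hY
        refine hs.code_lt_code hn c hX hχ h₁ ?_
        rintro rfl
        exact h₂ (hg _ _ _ hX)
    have h₃ := sInf_bindingCodes_le c Ψ ψ
    have h₄ : Ψ.code c - sInf (bindingCodes c Ψ ψ) + 1 ≤
        Ψ.code c - sInf (bindingCodes c Ψ (var X)) := by omega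
    have h₅ := Nat.mul_le_mul_right (Ψ.code c + 1) h₄
    rw [rank, rank]
    rw [add_mul] at h₅
    omega
  case dia => exact absurd trivial hm
  case box => exact absurd trivial hm
  case fix => exact rank_lt_of_code_lt (code_lt_fix ..) subset_rfl
  case and_left φ =>
    exact rank_lt_of_code_lt (code_lt_of_child c (.and_left (Ψ := Ψ) ψ φ) (by simp))
      Set.subset_union_left
  case and_right φ =>
    exact rank_lt_of_code_lt (code_lt_of_child c (.and_right (Ψ := Ψ) φ ψ) (by simp))
      Set.subset_union_right
  case or_left φ =>
    exact rank_lt_of_code_lt (code_lt_of_child c (.or_left (Ψ := Ψ) ψ φ) (by simp))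
      Set.subset_union_left
  case or_right φ =>
    exact rank_lt_of_code_lt (code_lt_of_child c (.or_right (Ψ := Ψ) φ ψ) (by simp))
      Set.subset_union_right

/-! ### Lengths of modality-free paths. -/

/-- Paths in the parse tree of `Ψ` that contain no modality, except possibly as the last node. -/
def ModalityFreePath (Ψ : Formula α) (l : List (Formula α)) : Prop :=
  (∀ φ ∈ l, φ ∈ Ψ.sub) ∧ l.IsChain (Child Ψ) ∧ ∀ φ ∈ l.dropLast, ¬ φ.Modality

theorem ModalityFreePath.length_le (c : α → ℕ) (hs : Ψ.IsSentence) (hn : Ψ.WellNamed)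
    (hg : Ψ.Guarded) {l : List (Formula α)} (h : ModalityFreePath Ψ l) :
    l.length ≤ (Ψ.code c + 1) ^ 2 := by
  have key : ∀ l : List (Formula α), ∀ φ, ModalityFreePath Ψ (φ :: l) →
      (φ :: l).length ≤ rank c Ψ φ + 1 := by
    intro l
    induction l with
    | nil => simp
    | cons ψ l ih =>
      rintro φ ⟨h₁, h₂, h₃⟩
      rw [List.isChain_cons_cons] at h₂
      rw [List.dropLast_cons_of_ne_nil (by simp)] at h₃
      have := ih ψ ⟨fun χ hχ => h₁ χ (.tail _ hχ), h₂.2, fun χ hχ => h₃ χ (.tail _ hχ)⟩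
      have := rank_lt_of_child c hs hn hg (h₁ φ (.head _)) (h₃ φ (.head _)) h₂.1
      simp only [List.length_cons] at *
      omega
  cases l with
  | nil => simp
  | cons φ l => exact (key l φ h).trans (rank_lt (h.1 φ (.head _)))

theorem modalityFreeLength_eq (Ψ : Formula α) :
    Ψ.modalityFreeLength = sSup {k | ∃ l, l.length = k ∧ ModalityFreePath Ψ l} :=
  rfl

/-- The supremum is a genuine one only because lengths are bounded: in `ℕ` an unbounded set has
`sSup` equal to `0`. -/
theorem ModalityFreePath.length_le_modalityFreeLength (c : α → ℕ) (hs : Ψ.IsSentence)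
    (hn : Ψ.WellNamed) (hg : Ψ.Guarded) {l : List (Formula α)} (h : ModalityFreePath Ψ l) :
    l.length ≤ Ψ.modalityFreeLength := by
  rw [modalityFreeLength_eq]
  refine le_csSup ⟨(Ψ.code c + 1) ^ 2, ?_⟩ ⟨l, rfl, h⟩
  rintro _ ⟨l, rfl, h⟩
  exact h.length_le c hs hn hg

end Formula

open Formula

theorem marksWithin_game {α : Type} (c : α → ℕ) {Ψ : Formula α} (hs : Ψ.IsSentence)
    (hn : Ψ.WellNamed) (hg : Ψ.Guarded) (T : Kripke α) (l : ℕ) (Ω : ℕ → ℕ) :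
    (game T Ψ l Ω).MarksWithin Ψ.modalityFreeLength := by
  intro L hL hm
  let f : (game T Ψ l Ω).V → Formula α := fun x => x.2.1
  rw [← List.length_map f]
  refine ModalityFreePath.length_le_modalityFreeLength c hs hn hg ⟨?_, ?_, ?_⟩
  · intro φ hφ
    obtain ⟨x, -, rfl⟩ := List.mem_map.1 hφ
    exact x.2.2
  · rw [List.isChain_map]
    exact hL.imp fun x y h => GameEdge.child h
  · intro φ hφ
    rw [← List.map_dropLast] at hφ
    obtain ⟨x, hx, rfl⟩ := List.mem_map.1 hφ
    exact hm x hx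

/-! ### Existence of priority assignments -/

/-- Assign to `X` twice the code of its body, plus one for a least fixpoint. Variables free in that
body other than `X` are bound further out, by bodies of larger code. -/
theorem exists_orderPreserving {α : Type} (c : α → ℕ) {Ψ : Formula α} (hs : Ψ.IsSentence)
    (hn : Ψ.WellNamed) : ∃ l q Ω, Ψ.OrderPreserving l q Ω := by
  classical
  let par : Binder → ℕ := fun η => match η with
    | .mu => 1
    | .nu => 0
  have hpar : ∀ η, par η ≤ 1 := by rintro (_ | _) <;> simp [par]
  have hΩ : ∃ Ω : ℕ → ℕ, ∀ η X φ, fix η X φ ∈ Ψ.sub → Ω X = 2 * φ.code c + par η := by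
    refine ⟨fun X => if h : ∃ x : Binder × Formula α, fix x.1 X x.2 ∈ Ψ.sub then
      2 * h.choose.2.code c + par h.choose.1 else 0, fun η X φ h => ?_⟩
    have h' : ∃ x : Binder × Formula α, fix x.1 X x.2 ∈ Ψ.sub := ⟨(η, φ), h⟩
    obtain ⟨h₁, h₂⟩ := hn _ _ _ _ _ h h'.choose_spec
    simp only [dif_pos h']
    rw [← h₁, ← h₂]
  obtain ⟨Ω, hΩ⟩ := hΩ
  refine ⟨0, 2 * Ψ.code c + 1, Ω, zero_le_one, Nat.zero_le _, ?_, ?_, ?_, ?_⟩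
  · intro η X φ h
    have := code_le_of_mem_sub c h
    have := code_lt_fix c η X φ
    have := hpar η
    rw [hΩ _ _ _ h]
    omega
  · intro X φ h
    rw [hΩ _ _ _ h]
    exact odd_two_mul_add_one _
  · intro X φ h
    rw [hΩ _ _ _ h]
    exact even_two_mul _
  · intro η Y φ X hY hX
    by_cases hXY : X = Y
    · rw [hXY]
    · obtain ⟨η', ψ, h, -⟩ := hs.exists_binding (Y := X) hY ⟨hX, hXY⟩
      have := hs.code_lt_code hn c hY h hX hXY
      have := hpar η
      rw [hΩ _ _ _ h, hΩ _ _ _ hY]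
      omega

/-! ### The semantic modal depth -/

section SemanticDepth

variable {α : Type} {Ψ : Formula α}

/-- The winner on a truncated tree does not depend on the priorities. As `Sat` asks for some
assignment, the converse needs one to exist. -/
theorem sat_truncate_iff (c : α → ℕ) (hs : Ψ.IsSentence) (hn : Ψ.WellNamed) (hg : Ψ.Guarded)
    {T : Kripke α} (hT : T.IsRegularTree) (n : ℕ) :
    Sat (T.truncate n) Ψ ↔ Holds T Ψ n T.root Ψ := by
  constructor
  · rintro ⟨l, q, Ω, -, h⟩
    exact (evenWins_truncate_iff_holds hT (marksWithin_game c hs hn hg T l Ω) n).1 h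
  · intro h
    obtain ⟨l, q, Ω, hΩ⟩ := exists_orderPreserving c hs hn
    exact ⟨l, q, Ω, hΩ,
      (evenWins_truncate_iff_holds hT (marksWithin_game c hs hn hg T l Ω) n).2 h⟩

theorem eval_truncate {T : Kripke α} {n : ℕ} {φ : Formula α} (s : (T.truncate n).S) {d : ℕ}
    (hs : T.AtDepth d s.1) (hd : d + φ.depth ≤ n) :
    φ.Eval (T.truncate n) s ↔ φ.Eval T s.1 := by
  induction φ generalizing s d with
  | pos => rfl
  | neg => rfl
  | and φ ψ ih₁ ih₂ =>
    have hd' : d + max φ.depth ψ.depth ≤ n := hd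
    rw [eval_and, eval_and, ih₁ s hs (by omega), ih₂ s hs (by omega)]
  | or φ ψ ih₁ ih₂ =>
    have hd' : d + max φ.depth ψ.depth ≤ n := hd
    rw [eval_or, eval_or, ih₁ s hs (by omega), ih₂ s hs (by omega)]
  | dia φ ih =>
    have hd' : d + (φ.depth + 1) ≤ n := hd
    rw [eval_dia, eval_dia]
    constructor
    · rintro ⟨t, hE, ht⟩
      exact ⟨t.1, hE, (ih t (d := d + 1) ⟨_, hs, hE⟩ (by omega)).1 ht⟩
    · rintro ⟨t, hE, ht⟩
      have h : T.AtDepth (d + 1) t := ⟨_, hs, hE⟩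
      exact ⟨⟨t, d + 1, by omega, h⟩, hE, (ih _ h (by omega)).2 ht⟩
  | box φ ih =>
    have hd' : d + (φ.depth + 1) ≤ n := hd
    rw [eval_box, eval_box]
    constructor
    · intro H t hE
      have h : T.AtDepth (d + 1) t := ⟨_, hs, hE⟩
      exact (ih ⟨t, d + 1, by omega, h⟩ h (by omega)).1 (H _ hE)
    · intro H t hE
      exact (ih t (d := d + 1) ⟨_, hs, hE⟩ (by omega)).2 (H t.1 hE)
  | _ => rfl

/-- Unfold the fixpoints, replacing modalities at counter `0` by constants. The recursion terminates
because the counter drops at modalities and the rank drops everywhere else. -/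
theorem exists_modal_holds (c : α → ℕ) (hs : Ψ.IsSentence) (hn : Ψ.WellNamed) (hg : Ψ.Guarded)
    (k : ℕ) (φ : Formula α) (hφ : φ ∈ Ψ.sub) : ∃ χ : Formula α, χ.IsModal ∧ χ.depth ≤ k ∧
      ∀ (T : Kripke α) s, Holds T Ψ k s φ ↔ χ.Eval T s := by
  induction k using Nat.strong_induction_on generalizing φ with
  | _ k ihk =>
  induction h : rank c Ψ φ using Nat.strong_induction_on generalizing φ with
  | _ r ih =>
  subst h
  have IH : ∀ ψ, ¬ φ.Modality → Child Ψ φ ψ → _ := fun ψ hm h =>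
    ih _ (rank_lt_of_child c hs hn hg hφ hm h) ψ (h.mem_sub hφ) rfl
  cases φ with
  | pos P => exact ⟨.pos P, trivial, Nat.zero_le _, fun T s => holds_pos hφ⟩
  | neg P => exact ⟨.neg P, trivial, Nat.zero_le _, fun T s => holds_neg hφ⟩
  | bot => exact ⟨.bot, trivial, Nat.zero_le _, fun T s => iff_of_false not_holds_bot id⟩
  | top => exact ⟨.top, trivial, Nat.zero_le _, fun T s => iff_of_true (holds_top hφ) trivial⟩
  | and φ ψ =>
    obtain ⟨χ₁, h₁, h₂, h₃⟩ := IH φ id (.and_left ..)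
    obtain ⟨χ₂, h₁', h₂', h₃'⟩ := IH ψ id (.and_right ..)
    exact ⟨.and χ₁ χ₂, ⟨h₁, h₁'⟩, max_le h₂ h₂', fun T s => by
      rw [holds_and hφ, eval_and, h₃, h₃']⟩
  | or φ ψ =>
    obtain ⟨χ₁, h₁, h₂, h₃⟩ := IH φ id (.or_left ..)
    obtain ⟨χ₂, h₁', h₂', h₃'⟩ := IH ψ id (.or_right ..)
    exact ⟨.or χ₁ χ₂, ⟨h₁, h₁'⟩, max_le h₂ h₂', fun T s => by
      rw [holds_or hφ, eval_or, h₃, h₃']⟩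
  | fix η X φ =>
    obtain ⟨χ, h₁, h₂, h₃⟩ := IH φ id (.fix ..)
    exact ⟨χ, h₁, h₂, fun T s => by rw [holds_fix hφ, h₃]⟩
  | var X =>
    obtain ⟨η, φ, hX, -⟩ := hs.exists_binding hφ (Y := X) rfl
    obtain ⟨χ, h₁, h₂, h₃⟩ := IH φ id (.var _ _ _ hX)
    refine ⟨χ, h₁, h₂, fun T s => ?_⟩
    rw [holds_var hφ, ← h₃]
    constructor
    · rintro ⟨η', φ', h, h'⟩
      obtain ⟨-, rfl⟩ := hn _ _ _ _ _ hX h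
      exact h'
    · exact fun h => ⟨η, φ, hX, h⟩
  | dia φ =>
    cases k with
    -- At counter `0` the owner of the modality loses: hence `bot` for a diamond and, below, `top`
    -- for a box.
    | zero => exact ⟨.bot, trivial, le_rfl, fun T s => by simp [holds_dia hφ, eval_bot]⟩
    | succ k =>
      obtain ⟨χ, h₁, h₂, h₃⟩ := ihk k k.lt_succ_self φ ((Child.dia φ).mem_sub hφ)
      exact ⟨.dia χ, h₁, Nat.succ_le_succ h₂, fun T s => by
        simp [holds_dia hφ, eval_dia, h₃]⟩
  | box φ =>
    cases k with
    | zero => exact ⟨.top, trivial, le_rfl, fun T s => by simp [holds_box hφ, eval_top]⟩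
    | succ k =>
      obtain ⟨χ, h₁, h₂, h₃⟩ := ihk k k.lt_succ_self φ ((Child.box φ).mem_sub hφ)
      exact ⟨.box χ, h₁, Nat.succ_le_succ h₂, fun T s => by
        simp [holds_box hφ, eval_box, h₃]⟩

/-- Truncating trees at depth `k` does not matter for `Ψ`. -/
def ModalAt (Ψ : Formula α) (k : ℕ) : Prop :=
  ∀ T : Kripke α, T.IsRegularTree → (Sat T Ψ ↔ Holds T Ψ k T.root Ψ)

/-- `Φ` has the same value on `T` and on its truncation at `Φ.depth`, and equivalence carries this
over to `Ψ`, the truncation being again a regular tree. -/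
theorem modalAt_depth (c : α → ℕ) (hs : Ψ.IsSentence) (hn : Ψ.WellNamed) (hg : Ψ.Guarded)
    {Φ : Formula α} (hΦ : Φ.IsModal) (h : Equivalent Ψ Φ) : ModalAt Ψ Φ.depth := by
  intro T hT
  rw [← sat_truncate_iff c hs hn hg hT, h T hT, h _ (hT.truncate _), sat_iff_eval hΦ,
    sat_iff_eval hΦ]
  exact (eval_truncate (T.truncate Φ.depth).root (d := 0) rfl (by simp)).symm

theorem ModalAt.exists_modal (c : α → ℕ) (hs : Ψ.IsSentence) (hn : Ψ.WellNamed) (hg : Ψ.Guarded)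
    {k : ℕ} (h : ModalAt Ψ k) : ∃ Φ : Formula α, Φ.IsModal ∧ Φ.depth ≤ k ∧ Equivalent Ψ Φ := by
  obtain ⟨χ, h₁, h₂, h₃⟩ := exists_modal_holds c hs hn hg k Ψ Ψ.self_mem_sub
  exact ⟨χ, h₁, h₂, fun T hT => by rw [h T hT, h₃, sat_iff_eval h₁]⟩

/-- Passes through the modal unfolding of depth at most `k`, which cannot see a truncation at `k'`.
-/
theorem ModalAt.mono (c : α → ℕ) (hs : Ψ.IsSentence) (hn : Ψ.WellNamed) (hg : Ψ.Guarded)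
    {k k' : ℕ} (h : ModalAt Ψ k) (hk : k ≤ k') : ModalAt Ψ k' := by
  intro T hT
  obtain ⟨χ, h₁, h₂, h₃⟩ := exists_modal_holds c hs hn hg k Ψ Ψ.self_mem_sub
  rw [← sat_truncate_iff c hs hn hg hT, h T hT, h _ (hT.truncate _), h₃, h₃]
  exact (eval_truncate (T.truncate k').root (d := 0) rfl (by omega)).symm

theorem modalAt_semanticModalDepth (c : α → ℕ) (hs : Ψ.IsSentence) (hn : Ψ.WellNamed)
    (hg : Ψ.Guarded) (h : SemanticallyModal Ψ) : ModalAt Ψ (semanticModalDepth Ψ) := by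
  obtain ⟨Φ, h₁, h₂⟩ := h
  obtain ⟨Φ, h₁, h₂, h₃⟩ := Nat.sInf_mem
    (s := {d | ∃ Φ : Formula α, Φ.IsModal ∧ Φ.depth = d ∧ Equivalent Ψ Φ}) ⟨_, Φ, h₁, rfl, h₂⟩
  rw [semanticModalDepth, ← h₂]
  exact modalAt_depth c hs hn hg h₁ h₃

theorem ModalAt.semanticModalDepth_le (c : α → ℕ) (hs : Ψ.IsSentence) (hn : Ψ.WellNamed)
    (hg : Ψ.Guarded) {k : ℕ} (h : ModalAt Ψ k) : semanticModalDepth Ψ ≤ k := by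
  obtain ⟨Φ, h₁, h₂, h₃⟩ := h.exists_modal c hs hn hg
  have : semanticModalDepth Ψ ≤ Φ.depth := Nat.sInf_le ⟨Φ, h₁, rfl, h₃⟩
  exact this.trans h₂

/-! ### The semantic modal depth as the last difference between consecutive truncations. -/

/-- Truncating at depth `j` and at depth `j + 1` makes a difference for `Ψ`. -/
def Separates (Ψ : Formula α) (j : ℕ) : Prop :=
  ∃ T : Kripke α, T.IsRegularTree ∧ ¬ (Holds T Ψ (j + 1) T.root Ψ ↔ Holds T Ψ j T.root Ψ)

theorem not_separates_of_le (c : α → ℕ) (hs : Ψ.IsSentence) (hn : Ψ.WellNamed)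
    (hg : Ψ.Guarded) (h : SemanticallyModal Ψ) {j : ℕ} (hj : semanticModalDepth Ψ ≤ j) :
    ¬ Separates Ψ j := by
  rintro ⟨T, hT, H⟩
  have hm := modalAt_semanticModalDepth c hs hn hg h
  exact H ((hm.mono c hs hn hg (hj.trans j.le_succ) T hT).symm.trans (hm.mono c hs hn hg hj T hT))

/-- Otherwise truncation at `j` would agree with truncation at `j + 1`, hence with `Ψ`, and the
unfolding would be an equivalent modal formula of depth at most `j`, against minimality. -/
theorem separates_of_eq_succ (c : α → ℕ) (hs : Ψ.IsSentence) (hn : Ψ.WellNamed)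
    (hg : Ψ.Guarded) (h : SemanticallyModal Ψ) {j : ℕ} (hj : semanticModalDepth Ψ = j + 1) :
    Separates Ψ j := by
  by_contra H
  have hm := modalAt_semanticModalDepth c hs hn hg h
  have : ModalAt Ψ j := by
    intro T hT
    rw [hm T hT, hj]
    by_contra h'
    exact H ⟨T, hT, h'⟩
  have := this.semanticModalDepth_le c hs hn hg
  omega

end SemanticDepth

/-! ### Computing with codes of formulas -/

/-- The first component of a code, which tells the kind of formula. -/
def tag (e : ℕ) : ℕ := e.unpair.1

/-- The second component of a code. -/
def arg (e : ℕ) : ℕ := e.unpair.2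

/-- The codes of the immediate subformulas. -/
def immediateSubCodes (e : ℕ) : List ℕ :=
  if tag e = 3 ∨ tag e = 4 then [(arg e).unpair.1, (arg e).unpair.2]
  else if tag e = 5 ∨ tag e = 6 then [arg e]
  else if tag e = 7 ∨ tag e = 8 then [(arg e).unpair.2]
  else []

/-- The codes of the subformulas. -/
def subCodes (c : ℕ) : List ℕ :=
  (fun L => L ++ L.flatMap immediateSubCodes)^[c] [c]

/-- The codes of the children in the parse tree of the formula of code `c`. -/
def childCodes (c e : ℕ) : List ℕ :=
  if tag e = 2 then
    ((subCodes c).filter fun d => (tag d = 7 ∨ tag d = 8) ∧ (arg d).unpair.1 = arg e).map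
      fun d => (arg d).unpair.2
  else immediateSubCodes e

/-- The codes of the last nodes of paths of `k + 1` nodes without modalities, except possibly as
the last node. -/
def pathEndCodes (c k : ℕ) : List ℕ :=
  (fun L => (L.filter fun e => ¬ (tag e = 5 ∨ tag e = 6)).flatMap (childCodes c))^[k] (subCodes c)

/-- The successor of the last `k < n` with property `P`, and `0` if there is none. -/
def lastSucc (P : ℕ → Prop) [DecidablePred P] (n : ℕ) : ℕ :=
  Nat.rec 0 (fun k m => if P k then k + 1 else m) n

/-- `modalityFreeLength`, computed from the code of a formula. -/
def modalityFreeLengthOfCode (c : ℕ) : ℕ :=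
  lastSucc (fun k => pathEndCodes c k ≠ []) ((c + 1) * (c + 1))

/-- The truth of the formula with code `e` at a state, computed from the list `a` of propositional
variables that hold there, the list `S` of sets of formulas that hold in its successors, and a
list `L` of codes of other formulas that hold in the state. -/
def LocallyTrue (c : ℕ) (a : List ℕ) (S : List (List ℕ)) (L : List ℕ) (e : ℕ) : Prop :=
  (tag e = 0 ∧ arg e ∈ a) ∨ (tag e = 1 ∧ arg e ∉ a) ∨
  (tag e = 3 ∧ ∀ d ∈ childCodes c e, d ∈ L) ∨
  ((tag e = 2 ∨ tag e = 4 ∨ tag e = 7 ∨ tag e = 8) ∧ ∃ d ∈ childCodes c e, d ∈ L) ∨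
  (tag e = 5 ∧ ∃ τ ∈ S, arg e ∈ τ) ∨ (tag e = 6 ∧ ∀ τ ∈ S, arg e ∈ τ) ∨ tag e = 10

instance (c : ℕ) (a : List ℕ) (S : List (List ℕ)) (L : List ℕ) :
    DecidablePred (LocallyTrue c a S L) := fun e => by
  unfold LocallyTrue
  infer_instance

/-- The codes of the subformulas that are true at a state. -/
def trueCodes (c : ℕ) (a : List ℕ) (S : List (List ℕ)) : List ℕ :=
  (fun L => (subCodes c).filter fun e => LocallyTrue c a S L e)^[(c + 1) * (c + 1)] []

/-- The sets of propositional variables that matter for a formula with code `c`. -/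
def labels (c : ℕ) : List (List ℕ) := (List.range (c + 1)).sublists'

/-- The sets of subformulas that hold at trees of depth `0`. -/
def leafTypes (c : ℕ) : List (List ℕ) := (labels c).map fun a => trueCodes c a []

/-- The pairs consisting of the sets of subformulas that hold at the root of some tree, truncated
at depth `1` and at depth `0`. -/
def initialPairs (c : ℕ) : List (List ℕ × List ℕ) :=
  (labels c).flatMap fun a => (leafTypes c).sublists'.map fun S =>
    (trueCodes c a S, trueCodes c a [])

/-- The pairs that arise when the root of a tree gets children with pairs in `D`. -/
def nextPairs (c : ℕ) (D : List (List ℕ × List ℕ)) : List (List ℕ × List ℕ) :=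
  (labels c).flatMap fun a => D.sublists'.map fun S =>
    (trueCodes c a (S.map Prod.fst), trueCodes c a (S.map Prod.snd))

/-- The pairs consisting of the sets of subformulas that hold at the root of some tree, truncated
at depth `j + 1` and at depth `j`. -/
def typePairs (c j : ℕ) : List (List ℕ × List ℕ) := (nextPairs c)^[j] (initialPairs c)

/-- The code `c` tells some of the pairs apart. -/
def TellsApart (c : ℕ) (D : List (List ℕ × List ℕ)) : Prop :=
  ∃ x ∈ D, ¬ (c ∈ x.1 ↔ c ∈ x.2)

instance (c : ℕ) : DecidablePred (TellsApart c) := fun D => by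
  unfold TellsApart
  infer_instance

/-- A bound for the number of values of `typePairs c`. -/
def typePairsBound (c : ℕ) : ℕ :=
  2 ^ (2 ^ (subCodes c).length * 2 ^ (subCodes c).length)

/-- `semanticModalDepth`, computed from the code of a semantically modal formula. -/
def semanticModalDepthOfCode (c : ℕ) : ℕ :=
  lastSucc (fun j => TellsApart c (typePairs c j)) (typePairsBound c)

/-- The codes of `ownedByEven l q` and `ownedByOdd l q`, for `k = 0` and `k = 1`. -/
def ownerCode (k l q : ℕ) : ℕ :=
  ((List.range (q + 1 - l)).map (l + ·)).foldr
    (fun i e => Nat.pair 4 (Nat.pair (Nat.pair 0 (Nat.pair k i)) e)) (Nat.pair 9 0)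

/-- The code of one unfolding of `boundedFormula`. -/
def stepCode (l q u v e : ℕ) : ℕ :=
  let M := Nat.pair 0 (Nat.pair 2 0)
  let N := Nat.pair 1 (Nat.pair 2 0)
  let and := fun x y => Nat.pair 3 (Nat.pair x y)
  let or := fun x y => Nat.pair 4 (Nat.pair x y)
  or (and (ownerCode 0 l q) (and N (Nat.pair 5 e)))
    (or (and (ownerCode 0 l q) (and M u))
      (or (and (ownerCode 1 l q) (and N (Nat.pair 6 e))) (and (ownerCode 1 l q) (and M v))))

/-- The code of `boundedFormula l q p a b`, computed from the codes of the parts that follow the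
marked positions. -/
def rowCode (l q u v a : ℕ) : ℕ := (stepCode l q u v)^[a] (Nat.pair 9 0)

/-- The code of `boundedFormula l q p p b`. -/
def boundedCode (l q p b : ℕ) : ℕ :=
  (fun e => rowCode l q (Nat.pair 5 e) (Nat.pair 6 e) p)^[b]
    (rowCode l q (Nat.pair 9 0) (Nat.pair 10 0) p)

/-! ### Primitive recursiveness -/

open Primrec

theorem primrec_tag : Primrec tag := fst.comp unpair

theorem primrec_arg : Primrec arg := snd.comp unpair

theorem primrecPred_tag_eq (n : ℕ) : PrimrecPred fun e => tag e = n :=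
  Primrec.eq.comp primrec_tag (const n)

theorem primrec_unpair_arg_fst : Primrec fun e => (arg e).unpair.1 :=
  fst.comp (unpair.comp primrec_arg)

theorem primrec_unpair_arg_snd : Primrec fun e => (arg e).unpair.2 :=
  snd.comp (unpair.comp primrec_arg)

theorem primrec_immediateSubCodes : Primrec immediateSubCodes := by
  refine ite ((primrecPred_tag_eq 3).or (primrecPred_tag_eq 4))
    (list_cons.comp primrec_unpair_arg_fst (list_cons.comp primrec_unpair_arg_snd (const [])))
    (ite ((primrecPred_tag_eq 5).or (primrecPred_tag_eq 6))
      (list_cons.comp primrec_arg (const []))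
      (ite ((primrecPred_tag_eq 7).or (primrecPred_tag_eq 8))
        (list_cons.comp primrec_unpair_arg_snd (const [])) (const [])))

theorem primrec_subCodes : Primrec subCodes := by
  refine nat_iterate .id (list_cons.comp .id (const [])) (h := fun _ L =>
    L ++ L.flatMap immediateSubCodes) ?_
  exact list_append.comp snd (list_flatMap snd (primrec_immediateSubCodes.comp snd).to₂)

theorem primrec_childCodes : Primrec₂ childCodes := by
  have hR : PrimrecRel fun (d X : ℕ) => (tag d = 7 ∨ tag d = 8) ∧ (arg d).unpair.1 = X :=
    PrimrecPred.and (PrimrecPred.or ((primrecPred_tag_eq 7).comp fst)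
      ((primrecPred_tag_eq 8).comp fst))
      (Primrec.eq.comp (primrec_unpair_arg_fst.comp fst) snd)
  refine ite ((primrecPred_tag_eq 2).comp snd) ?_ (primrec_immediateSubCodes.comp snd)
  exact list_map (hR.listFilter.comp (primrec_subCodes.comp fst) (primrec_arg.comp snd))
    (primrec_unpair_arg_snd.comp snd).to₂

theorem primrec_pathEndCodes : Primrec₂ pathEndCodes := by
  have hR : PrimrecPred fun e : ℕ => ¬ (tag e = 5 ∨ tag e = 6) :=
    ((primrecPred_tag_eq 5).or (primrecPred_tag_eq 6)).not
  refine nat_iterate snd (primrec_subCodes.comp fst) (h := fun (x : ℕ × ℕ) L =>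
    (L.filter fun e => ¬ (tag e = 5 ∨ tag e = 6)).flatMap (childCodes x.1)) ?_
  exact list_flatMap ((listFilter hR).comp snd)
    (primrec_childCodes.comp (fst.comp (fst.comp fst)) snd).to₂

theorem primrec_lastSucc {α : Type*} [Primcodable α] {f : α → ℕ} {P : α → ℕ → Prop}
    [∀ a, DecidablePred (P a)] (hf : Primrec f) (hP : PrimrecRel P) :
    Primrec fun a => lastSucc (P a) (f a) := by
  refine nat_rec' hf (const 0) (h := fun a x => if P a x.1 then x.1 + 1 else x.2) ?_
  exact ite (hP.comp fst (fst.comp snd)) (succ.comp (fst.comp snd)) (snd.comp snd)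

theorem primrec_modalityFreeLengthOfCode : Primrec modalityFreeLengthOfCode :=
  primrec_lastSucc (nat_mul.comp succ succ)
    (P := fun c k => pathEndCodes c k ≠ [])
    (Primrec.eq.comp (primrec_pathEndCodes.comp fst snd) (const [])).not

theorem primrecRel_mem {α : Type*} [Primcodable α] : PrimrecRel fun (a : α) (L : List α) => a ∈ L :=
  ((PrimrecRel.exists_mem_list (Primrec.eq (α := α))).swap).of_eq fun a L => by simp [Function.swap]

theorem primrec_trueCodes :
    Primrec fun x : ℕ × List ℕ × List (List ℕ) => trueCodes x.1 x.2.1 x.2.2 := by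
  have hR : PrimrecRel fun (e : ℕ) (x : (ℕ × List ℕ × List (List ℕ)) × List ℕ) =>
      LocallyTrue x.1.1 x.1.2.1 x.1.2.2 x.2 e := by
    let γ := ℕ × (ℕ × List ℕ × List (List ℕ)) × List ℕ
    have he : Primrec fun y : γ => arg y.1 := primrec_arg.comp fst
    have ha : Primrec fun y : γ => y.2.1.2.1 := fst.comp (snd.comp (fst.comp snd))
    have hS : Primrec fun y : γ => y.2.1.2.2 := snd.comp (snd.comp (fst.comp snd))
    have hL : Primrec fun y : γ => y.2.2 := snd.comp snd
    have hch : Primrec fun y : γ => childCodes y.2.1.1 y.1 :=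
      primrec_childCodes.comp (fst.comp (fst.comp snd)) fst
    have ht : ∀ n, PrimrecPred fun y : γ => tag y.1 = n := fun n => (primrecPred_tag_eq n).comp fst
    have hmem := primrecRel_mem (α := ℕ)
    have hτ : PrimrecRel fun (τ : List ℕ) (e : ℕ) => e ∈ τ := hmem.swap
    exact ((ht 0).and (hmem.comp he ha)).or <| ((ht 1).and (hmem.comp he ha).not).or <|
      ((ht 3).and (hmem.forall_mem_list.comp hch hL)).or <|
      (((ht 2).or ((ht 4).or ((ht 7).or (ht 8)))).and (hmem.exists_mem_list.comp hch hL)).or <|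
      ((ht 5).and (hτ.exists_mem_list.comp hS he)).or <|
      ((ht 6).and (hτ.forall_mem_list.comp hS he)).or (ht 10)
  refine nat_iterate (nat_mul.comp (succ.comp fst) (succ.comp fst)) (const [])
    (h := fun (x : ℕ × List ℕ × List (List ℕ)) L => (subCodes x.1).filter fun e => LocallyTrue x.1 x.2.1 x.2.2 L e) ?_
  exact hR.listFilter.comp (primrec_subCodes.comp (fst.comp fst)) .id

theorem primrec_sublists' {α : Type*} [Primcodable α] : Primrec (List.sublists' (α := α)) := by
  refine Primrec.of_eq (list_foldr .id (const [[]])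
    (h := fun _ (x : α × List (List α)) => x.2 ++ x.2.map (x.1 :: ·)) ?_) fun L => ?_
  · exact list_append.comp (snd.comp snd)
      (list_map (snd.comp snd) (list_cons.comp (fst.comp (snd.comp fst)) snd).to₂)
  · induction L with
    | nil => rfl
    | cons a L ih => rw [List.sublists'_cons, ← ih]; rfl

theorem primrec_labels : Primrec labels :=
  primrec_sublists'.comp (list_range.comp succ)

theorem primrec_leafTypes : Primrec leafTypes :=
  list_map primrec_labels (primrec_trueCodes.comp (.pair fst (.pair snd (const [])))).to₂

theorem primrec_initialPairs : Primrec initialPairs := by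
  have h₁ : Primrec fun x : (ℕ × List ℕ) × List (List ℕ) =>
      (trueCodes x.1.1 x.1.2 x.2, trueCodes x.1.1 x.1.2 []) :=
    .pair
      (primrec_trueCodes.comp (.pair (fst.comp fst) (.pair (snd.comp fst) snd)))
      (primrec_trueCodes.comp (.pair (fst.comp fst) (.pair (snd.comp fst) (const []))))
  have h₂ : Primrec fun x : ℕ × List ℕ => (leafTypes x.1).sublists'.map fun S =>
      (trueCodes x.1 x.2 S, trueCodes x.1 x.2 []) :=
    list_map (primrec_sublists'.comp (primrec_leafTypes.comp fst)) h₁.to₂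
  exact list_flatMap primrec_labels h₂.to₂

theorem primrec_nextPairs : Primrec₂ nextPairs := by
  have h₁ : Primrec fun x : ((ℕ × List (List ℕ × List ℕ)) × List ℕ) × List (List ℕ × List ℕ) =>
      (trueCodes x.1.1.1 x.1.2 (x.2.map Prod.fst), trueCodes x.1.1.1 x.1.2 (x.2.map Prod.snd)) :=
    .pair
      (primrec_trueCodes.comp (.pair (fst.comp (fst.comp fst))
        (.pair (snd.comp fst) (list_map snd (fst.comp snd).to₂))))
      (primrec_trueCodes.comp (.pair (fst.comp (fst.comp fst))
        (.pair (snd.comp fst) (list_map snd (snd.comp snd).to₂))))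
  have h₂ : Primrec fun x : (ℕ × List (List ℕ × List ℕ)) × List ℕ =>
      x.1.2.sublists'.map fun S =>
        (trueCodes x.1.1 x.2 (S.map Prod.fst), trueCodes x.1.1 x.2 (S.map Prod.snd)) :=
    list_map (primrec_sublists'.comp (snd.comp fst)) h₁.to₂
  exact list_flatMap (primrec_labels.comp fst) h₂.to₂

theorem primrec_typePairs : Primrec₂ typePairs :=
  nat_iterate snd (primrec_initialPairs.comp fst) (h := fun (x : ℕ × ℕ) D => nextPairs x.1 D)
    (primrec_nextPairs.comp (fst.comp fst) snd)

theorem primrecRel_tellsApart : PrimrecRel TellsApart := by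
  have hR : PrimrecRel fun (x : List ℕ × List ℕ) (c : ℕ) => ¬ (c ∈ x.1 ↔ c ∈ x.2) := by
    have h₁ : PrimrecPred fun y : (List ℕ × List ℕ) × ℕ => y.2 ∈ y.1.1 :=
      primrecRel_mem.comp snd (fst.comp fst)
    have h₂ : PrimrecPred fun y : (List ℕ × List ℕ) × ℕ => y.2 ∈ y.1.2 :=
      primrecRel_mem.comp snd (snd.comp fst)
    exact ((h₁.and h₂.not).or (h₂.and h₁.not)).of_eq fun y => by tauto
  exact hR.exists_mem_list.swap

theorem primrec_two_pow : Primrec fun n : ℕ => 2 ^ n := by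
  refine Primrec.of_eq (nat_iterate .id (const 1) (h := fun (_ : ℕ) m => 2 * m)
    (nat_mul.comp (const 2) snd)) fun n => ?_
  induction n with
  | zero => rfl
  | succ n ih => rw [id, Function.iterate_succ_apply', pow_succ', ← ih]; rfl

theorem primrec_typePairsBound : Primrec typePairsBound :=
  have h := primrec_two_pow.comp (list_length.comp primrec_subCodes)
  primrec_two_pow.comp (nat_mul.comp h h)

theorem primrec_semanticModalDepthOfCode : Primrec semanticModalDepthOfCode :=
  primrec_lastSucc primrec_typePairsBound (P := fun c j => TellsApart c (typePairs c j))
    (primrecRel_tellsApart.comp fst primrec_typePairs)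

section BoundedCode

variable {α : Type*} [Primcodable α] {l q p u v e b : α → ℕ}

theorem primrec_pair_const (n : ℕ) (he : Primrec e) : Primrec fun x => Nat.pair n (e x) :=
  Primrec₂.natPair.comp (const n) he

theorem primrec_pair_pair (n : ℕ) (hu : Primrec u) (hv : Primrec v) :
    Primrec fun x => Nat.pair n (Nat.pair (u x) (v x)) :=
  primrec_pair_const n (Primrec₂.natPair.comp hu hv)

theorem primrec_ownerCode (k : ℕ) (hl : Primrec l) (hq : Primrec q) :
    Primrec fun x => ownerCode k (l x) (q x) := by
  refine list_foldr (list_map (list_range.comp (nat_sub.comp (succ.comp hq) hl))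
    (nat_add.comp (hl.comp fst) snd).to₂) (const (Nat.pair 9 0))
    (h := fun _ x => Nat.pair 4 (Nat.pair (Nat.pair 0 (Nat.pair k x.1)) x.2)) ?_
  exact primrec_pair_pair 4
    (primrec_pair_const 0 (primrec_pair_const k (fst.comp snd))) (snd.comp snd)

theorem primrec_stepCode (hl : Primrec l) (hq : Primrec q) (hu : Primrec u) (hv : Primrec v)
    (he : Primrec e) : Primrec fun x => stepCode (l x) (q x) (u x) (v x) (e x) :=
  have h₀ := primrec_ownerCode 0 hl hq
  have h₁ := primrec_ownerCode 1 hl hq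
  primrec_pair_pair 4
    (primrec_pair_pair 3 h₀ (primrec_pair_pair 3 (const _) (primrec_pair_const 5 he)))
    (primrec_pair_pair 4 (primrec_pair_pair 3 h₀ (primrec_pair_pair 3 (const _) hu))
      (primrec_pair_pair 4
        (primrec_pair_pair 3 h₁ (primrec_pair_pair 3 (const _) (primrec_pair_const 6 he)))
        (primrec_pair_pair 3 h₁ (primrec_pair_pair 3 (const _) hv))))

theorem primrec_rowCode (hl : Primrec l) (hq : Primrec q) (hu : Primrec u) (hv : Primrec v)
    (hp : Primrec p) : Primrec fun x => rowCode (l x) (q x) (u x) (v x) (p x) :=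
  nat_iterate hp (const _) (h := fun x e => stepCode (l x) (q x) (u x) (v x) e)
    (primrec_stepCode (hl.comp fst) (hq.comp fst) (hu.comp fst) (hv.comp fst) snd)

theorem primrec_boundedCode (hl : Primrec l) (hq : Primrec q) (hp : Primrec p)
    (hb : Primrec b) : Primrec fun x => boundedCode (l x) (q x) (p x) (b x) :=
  nat_iterate hb (primrec_rowCode hl hq (const _) (const _) hp)
    (h := fun x e => rowCode (l x) (q x) (Nat.pair 5 e) (Nat.pair 6 e) (p x))
    (primrec_rowCode (hl.comp fst) (hq.comp fst) (primrec_pair_const 5 snd)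
      (primrec_pair_const 6 snd) (hp.comp fst))

end BoundedCode

/-- The algorithm that computes the code of an interpreting formula. -/
def interpretingCode (x : ℕ × ℕ × ℕ) : ℕ :=
  boundedCode x.2.1 x.2.2 (modalityFreeLengthOfCode x.1) (semanticModalDepthOfCode x.1)

theorem computable_interpretingCode : Computable interpretingCode :=
  (primrec_boundedCode (fst.comp snd) (snd.comp snd) (primrec_modalityFreeLengthOfCode.comp fst)
    (primrec_semanticModalDepthOfCode.comp fst)).to_comp

/-! ### Codes of bounded formulas -/

theorem code_bigOr_map (f : ℕ → GameProp) (k : ℕ) (hf : ∀ i, (f i).code = Nat.pair k i)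
    (L : List ℕ) : (bigOr (L.map fun i => .pos (f i))).code GameProp.code =
      L.foldr (fun i e => Nat.pair 4 (Nat.pair (Nat.pair 0 (Nat.pair k i)) e)) (Nat.pair 9 0) := by
  induction L with
  | nil => rfl
  | cons i L ih => simp [bigOr, Formula.code, hf, ih]

theorem code_ownedByEven (l q : ℕ) : (ownedByEven l q).code GameProp.code = ownerCode 0 l q := by
  rw [ownedByEven, code_bigOr_map _ 0 fun i => rfl, List.range'_eq_map_range]
  rfl

theorem code_ownedByOdd (l q : ℕ) : (ownedByOdd l q).code GameProp.code = ownerCode 1 l q := by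
  rw [ownedByOdd, code_bigOr_map _ 1 fun i => rfl, List.range'_eq_map_range]
  rfl

theorem code_boundedFormula_zero (l q p a : ℕ) :
    (boundedFormula l q p a 0).code GameProp.code =
      rowCode l q (Nat.pair 9 0) (Nat.pair 10 0) a := by
  induction a with
  | zero => rw [boundedFormula]; rfl
  | succ a ih =>
    rw [boundedFormula, rowCode, Function.iterate_succ_apply', ← rowCode, ← ih]
    simp only [Formula.code, code_ownedByEven, code_ownedByOdd]
    rfl

theorem code_boundedFormula_succ (l q p a b : ℕ) :
    (boundedFormula l q p a (b + 1)).code GameProp.code =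
      rowCode l q (Nat.pair 5 ((boundedFormula l q p p b).code GameProp.code))
        (Nat.pair 6 ((boundedFormula l q p p b).code GameProp.code)) a := by
  induction a with
  | zero => rw [boundedFormula]; rfl
  | succ a ih =>
    rw [boundedFormula, rowCode, Function.iterate_succ_apply', ← rowCode, ← ih]
    simp only [Formula.code, code_ownedByEven, code_ownedByOdd]
    rfl

theorem code_boundedFormula (l q p b : ℕ) :
    (boundedFormula l q p p b).code GameProp.code = boundedCode l q p b := by
  induction b with
  | zero => rw [code_boundedFormula_zero, boundedCode, Function.iterate_zero_apply]
  | succ b ih =>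
    rw [code_boundedFormula_succ, ih, boundedCode, boundedCode, Function.iterate_succ_apply']

/-! ### Correctness of the computations with codes -/

section Spec

variable {Ψ φ ψ : Formula ℕ} {e : ℕ}

theorem child_and_iff {χ : Formula ℕ} : Child Ψ (and φ ψ) χ ↔ χ = φ ∨ χ = ψ := by
  constructor
  · rintro (_ | _) <;> simp
  · rintro (rfl | rfl) <;> constructor

theorem child_or_iff {χ : Formula ℕ} : Child Ψ (or φ ψ) χ ↔ χ = φ ∨ χ = ψ := by
  constructor
  · rintro (_ | _) <;> simp
  · rintro (rfl | rfl) <;> constructor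

theorem child_dia_iff {χ : Formula ℕ} : Child Ψ (dia φ) χ ↔ χ = φ := by
  constructor
  · rintro ⟨⟩; rfl
  · rintro rfl; constructor

theorem child_box_iff {χ : Formula ℕ} : Child Ψ (box φ) χ ↔ χ = φ := by
  constructor
  · rintro ⟨⟩; rfl
  · rintro rfl; constructor

theorem child_fix_iff {η : Binder} {X : ℕ} {χ : Formula ℕ} : Child Ψ (fix η X φ) χ ↔ χ = φ := by
  constructor
  · rintro ⟨⟩; rfl
  · rintro rfl; constructor

theorem child_var_iff {X : ℕ} {χ : Formula ℕ} :
    Child Ψ (var X) χ ↔ ∃ η, fix η X χ ∈ Ψ.sub := by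
  constructor
  · rintro (_ | _); exact ⟨_, ‹_›⟩
  · rintro ⟨η, h⟩; exact .var η X χ h

theorem mem_immediateSubCodes (hφ : ∀ X, φ ≠ var X) :
    e ∈ immediateSubCodes (φ.code id) ↔ ∃ ψ, Child Ψ φ ψ ∧ ψ.code id = e := by
  cases φ with
  | var X => exact absurd rfl (hφ X)
  | and φ ψ => simp [immediateSubCodes, tag, arg, code, child_and_iff, eq_comm]
  | or φ ψ => simp [immediateSubCodes, tag, arg, code, child_or_iff, eq_comm]
  | dia φ => simp [immediateSubCodes, tag, arg, code, child_dia_iff, eq_comm]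
  | box φ => simp [immediateSubCodes, tag, arg, code, child_box_iff, eq_comm]
  | fix η X φ => cases η <;> simp [immediateSubCodes, tag, arg, code, child_fix_iff, eq_comm]
  | _ =>
    simp only [immediateSubCodes, tag, arg, code, Nat.unpair_pair]
    norm_num
    rintro ψ ⟨⟩

theorem immediateSubCodes_var (X : ℕ) : immediateSubCodes ((var X : Formula ℕ).code id) = [] := by
  simp [immediateSubCodes, tag, code]

theorem mem_sub_cases (Ψ : Formula ℕ) (h : φ ∈ ψ.sub) :
    φ = ψ ∨ (∀ X, ψ ≠ var X) ∧ ∃ χ, Child Ψ ψ χ ∧ φ ∈ χ.sub := by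
  cases ψ with
  | and φ ψ => simpa [sub, child_and_iff] using h
  | or φ ψ => simpa [sub, child_or_iff] using h
  | dia φ => simpa [sub, child_dia_iff] using h
  | box φ => simpa [sub, child_box_iff] using h
  | fix η X φ => simpa [sub, child_fix_iff] using h
  | _ => exact .inl h

/-- Each round adds one level of immediate subformulas. Codes drop strictly along each level, so as
many rounds as the code of `Ψ` reach everything. -/
theorem mem_subCodes : e ∈ subCodes (Ψ.code id) ↔ ∃ φ ∈ Ψ.sub, φ.code id = e := by
  let I : ℕ → List ℕ := fun n => (fun L => L ++ L.flatMap immediateSubCodes)^[n] [Ψ.code id]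
  have hI : ∀ n, I (n + 1) = I n ++ (I n).flatMap immediateSubCodes := fun n =>
    Function.iterate_succ_apply' ..
  have hmono : Monotone fun n => {e | e ∈ I n} := monotone_nat_of_le_succ fun n e he => by
    change e ∈ I (n + 1)
    rw [hI]
    exact List.mem_append_left _ he
  constructor
  · suffices H : ∀ n, ∀ e ∈ I n, ∃ φ ∈ Ψ.sub, φ.code id = e from H _ e
    intro n
    induction n with
    | zero =>
      intro e he
      exact ⟨Ψ, Ψ.self_mem_sub, (List.mem_singleton.1 he).symm⟩
    | succ n ih =>
      intro e he
      rw [hI, List.mem_append, List.mem_flatMap] at he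
      rcases he with he | ⟨d, hd, he⟩
      · exact ih e he
      · obtain ⟨φ, hφ, rfl⟩ := ih d hd
        by_cases hv : ∀ X, φ ≠ var X
        · obtain ⟨ψ, hψ, rfl⟩ := (mem_immediateSubCodes (Ψ := Ψ) hv).1 he
          exact ⟨ψ, hψ.mem_sub hφ, rfl⟩
        · push Not at hv
          obtain ⟨X, rfl⟩ := hv
          simp [immediateSubCodes_var] at he
  · rintro ⟨φ, hφ, rfl⟩
    suffices H : ∀ k, ∀ χ : Formula ℕ, χ.code id ≤ k → φ ∈ χ.sub → ∀ n, χ.code id ∈ I n →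
        φ.code id ∈ I (n + k) by
      have := H (Ψ.code id) Ψ le_rfl hφ 0 (List.mem_singleton_self _)
      rwa [zero_add] at this
    intro k
    induction k with
    | zero =>
      intro χ hk hχ n hn
      rcases mem_sub_cases Ψ hχ with rfl | ⟨hv, ψ, hψ, -⟩
      · exact hn
      · have := code_lt_of_child id hψ hv
        omega
    | succ k ih =>
      intro χ hk hχ n hn
      rcases mem_sub_cases Ψ hχ with rfl | ⟨hv, ψ, hψ, hφψ⟩
      · exact hmono (Nat.le_add_right _ _) hn
      · have := code_lt_of_child id hψ hv
        have h := ih ψ (by omega) hφψ (n + 1) (by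
          rw [hI]
          exact List.mem_append_right _ (List.mem_flatMap.2
            ⟨_, hn, (mem_immediateSubCodes (Ψ := Ψ) hv).2 ⟨ψ, hψ, rfl⟩⟩))
        rwa [show n + (k + 1) = n + 1 + k by omega]

/-- This holds for every formula `φ` that has the given code, which is why the later specifications
never need codes to be injective. -/
theorem mem_childCodes :
    e ∈ childCodes (Ψ.code id) (φ.code id) ↔ ∃ ψ, Child Ψ φ ψ ∧ ψ.code id = e := by
  by_cases hv : ∀ X, φ ≠ var X
  · rw [← mem_immediateSubCodes hv, childCodes, if_neg]
    cases φ with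
    | var X => exact absurd rfl (hv X)
    | fix η X φ => cases η <;> simp [tag, code]
    | _ => simp [tag, code]
  · push Not at hv
    obtain ⟨X, rfl⟩ := hv
    rw [childCodes, if_pos (by simp [tag, code])]
    simp only [List.mem_map, List.mem_filter, mem_subCodes, child_var_iff, decide_eq_true_eq]
    constructor
    · rintro ⟨_, ⟨⟨χ, hχ, rfl⟩, ht, hX⟩, rfl⟩
      cases χ
      case fix η Y ψ =>
        obtain rfl : Y = X := by cases η <;> simpa [arg, code] using hX
        exact ⟨ψ, ⟨η, hχ⟩, by cases η <;> simp [arg, code]⟩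
      all_goals simp [tag, code] at ht
    · rintro ⟨ψ, ⟨η, h⟩, rfl⟩
      exact ⟨_, ⟨⟨_, h, rfl⟩, by cases η <;> simp [tag, code], by cases η <;> simp [arg, code]⟩,
        by cases η <;> simp [arg, code]⟩

/-- Only the values of `P` at `m - 1` and from `m` on matter, so `P` may be arbitrary below. -/
theorem lastSucc_eq {P : ℕ → Prop} [DecidablePred P] {m n : ℕ} (hmn : m ≤ n)
    (h : ∀ k, m ≤ k → ¬ P k) (h' : ∀ k, m = k + 1 → P k) : lastSucc P n = m := by
  induction n with
  | zero =>
    obtain rfl : m = 0 := by omega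
    rfl
  | succ n ih =>
    change (if P n then n + 1 else lastSucc P n) = m
    split_ifs with hn
    · by_contra hne
      exact h n (by omega) hn
    · refine ih ?_
      by_contra hlt
      exact hn (h' n (by omega))

theorem tag_eq_iff_modality (φ : Formula ℕ) :
    (tag (φ.code id) = 5 ∨ tag (φ.code id) = 6) ↔ φ.Modality := by
  cases φ with
  | fix η X φ => cases η <;> simp [tag, code, Modality]
  | _ => simp [tag, code, Modality]

/-- The last node is kept apart because it alone may be a modality. When the path is extended it
becomes an inner node, and the filter discards it if it is one. -/
theorem mem_pathEndCodes {k : ℕ} : e ∈ pathEndCodes (Ψ.code id) k ↔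
    ∃ l φ, ModalityFreePath Ψ (l ++ [φ]) ∧ l.length = k ∧ φ.code id = e := by
  induction k generalizing e with
  | zero =>
    rw [pathEndCodes, Function.iterate_zero_apply, mem_subCodes]
    constructor
    · rintro ⟨φ, hφ, rfl⟩
      exact ⟨[], φ, ⟨by simpa using hφ, by simp, by simp⟩, rfl, rfl⟩
    · rintro ⟨l, φ, h, -, rfl⟩
      exact ⟨φ, h.1 φ (by simp), rfl⟩
  | succ k ih =>
    rw [pathEndCodes, Function.iterate_succ_apply', ← pathEndCodes, List.mem_flatMap]
    simp only [List.mem_filter, ih, decide_eq_true_eq]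
    constructor
    · rintro ⟨_, ⟨⟨l, φ, h, rfl, rfl⟩, hm⟩, he⟩
      rw [tag_eq_iff_modality] at hm
      obtain ⟨ψ, hψ, rfl⟩ := mem_childCodes.1 he
      refine ⟨l ++ [φ], ψ, ⟨?_, ?_, ?_⟩, by simp, rfl⟩
      · intro χ hχ
        rcases List.mem_append.1 hχ with hχ | hχ
        · exact h.1 χ hχ
        · obtain rfl := List.mem_singleton.1 hχ
          exact hψ.mem_sub (h.1 φ (by simp))
      · rw [List.isChain_append]
        exact ⟨h.2.1, by simp, by simpa using hψ⟩
      · have := h.2.2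
        simp only [List.dropLast_concat] at this ⊢
        intro χ hχ
        rcases List.mem_append.1 hχ with hχ | hχ
        · exact this χ hχ
        · obtain rfl := List.mem_singleton.1 hχ
          exact hm
    · rintro ⟨l, ψ, h, hl, rfl⟩
      obtain rfl | ⟨l, φ, rfl⟩ := l.eq_nil_or_concat'
      · simp at hl
      · have h₂ := List.isChain_append.1 h.2.1
        have h₃ := h.2.2
        rw [List.dropLast_concat] at h₃
        refine ⟨_, ⟨⟨l, φ, ⟨fun χ hχ => h.1 χ (List.mem_append_left _ hχ), h₂.1, ?_⟩,
          by simpa using hl, rfl⟩, ?_⟩, mem_childCodes.2 ⟨ψ, by simpa using h₂.2.2, rfl⟩⟩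
        · rw [List.dropLast_concat]
          exact fun χ hχ => h₃ χ (by simp [hχ])
        · rw [tag_eq_iff_modality]
          exact h₃ φ (by simp)

theorem modalityFreeLengthOfCode_eq (hs : Ψ.IsSentence) (hn : Ψ.WellNamed) (hg : Ψ.Guarded) :
    modalityFreeLengthOfCode (Ψ.code id) = Ψ.modalityFreeLength := by
  obtain ⟨l, hl, h⟩ : Ψ.modalityFreeLength ∈ {k | ∃ l, l.length = k ∧ ModalityFreePath Ψ l} := by
    refine Nat.sSup_mem ⟨0, [], rfl, by simp, by simp, by simp⟩ ⟨(Ψ.code id + 1) ^ 2, ?_⟩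
    rintro _ ⟨l, rfl, h⟩
    exact h.length_le id hs hn hg
  -- The index `k` stands for paths of `k + 1` nodes, so the successor of the last index with a path
  -- is the maximal length.
  refine lastSucc_eq ?_ ?_ ?_
  · rw [← hl, ← sq]
    exact h.length_le id hs hn hg
  · intro k hk hne
    obtain ⟨e, he⟩ := List.exists_mem_of_ne_nil _ hne
    obtain ⟨l, φ, h, rfl, -⟩ := mem_pathEndCodes.1 he
    have := h.length_le_modalityFreeLength id hs hn hg
    simp at this
    omega
  · intro k hk
    obtain rfl | ⟨l, φ, rfl⟩ := l.eq_nil_or_concat'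
    · simp at hl
      omega
    · exact List.ne_nil_of_mem (mem_pathEndCodes.2
        ⟨l, φ, h, by simp at hl; omega, rfl⟩)

/-- The list `x` consists of codes of the formulas that hold at `s` in the `k`-bounded game. -/
def Matches (T : Kripke ℕ) (Ψ : Formula ℕ) (k : ℕ) (s : T.S) (x : List ℕ) : Prop :=
  ∀ φ ∈ Ψ.sub, φ.code id ∈ x ↔ Holds T Ψ k s φ

/-- After `f` rounds the list is correct on all subformulas of rank below `f`, since a formula that
is not a modality is decided by children of smaller rank and a modality by `S`. The counter enters
only through `S`, which must describe the successors at `k - 1` and be empty for `k = 0`. -/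
theorem matches_trueCodes (hs : Ψ.IsSentence) (hn : Ψ.WellNamed) (hg : Ψ.Guarded)
    {T : Kripke ℕ} {k : ℕ} {s : T.S} {a : List ℕ} {S : List (List ℕ)}
    (ha : ∀ P ≤ Ψ.code id, P ∈ a ↔ P ∈ T.label s)
    (hS₁ : ∀ τ ∈ S, ∃ j t, k = j + 1 ∧ T.E s t ∧ Matches T Ψ j t τ)
    (hS₂ : ∀ j t, k = j + 1 → T.E s t → ∃ τ ∈ S, Matches T Ψ j t τ) :
    Matches T Ψ k s (trueCodes (Ψ.code id) a S) := by
  have hP : ∀ {t P}, Nat.pair t P ≤ Ψ.code id → (P ∈ a ↔ P ∈ T.label s) := fun {t P} h =>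
    ha P ((Nat.right_le_pair t P).trans h)
  suffices H : ∀ f, ∀ φ ∈ Ψ.sub, rank id Ψ φ < f → (φ.code id ∈
      (fun L => (subCodes (Ψ.code id)).filter fun e => LocallyTrue (Ψ.code id) a S L e)^[f] [] ↔
        Holds T Ψ k s φ) by
    intro φ hφ
    -- The number of rounds in `trueCodes` is the uniform bound on ranks.
    refine H _ φ hφ ?_
    rw [← sq]
    exact rank_lt hφ
  intro f
  induction f with
  | zero => intro φ _ h; omega
  | succ f ih =>
    intro φ hφ hf
    rw [Function.iterate_succ_apply']
    set L := (fun L => (subCodes (Ψ.code id)).filter fun e =>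
      LocallyTrue (Ψ.code id) a S L e)^[f] []
    have IH : ∀ ψ, ¬ φ.Modality → Child Ψ φ ψ → (ψ.code id ∈ L ↔ Holds T Ψ k s ψ) := by
      intro ψ hm h
      have := rank_lt_of_child id hs hn hg hφ hm h
      exact ih ψ (h.mem_sub hφ) (by omega)
    have hc := code_le_of_mem_sub id hφ
    rw [List.mem_filter, decide_eq_true_eq,
      and_iff_right (mem_subCodes.2 ⟨φ, hφ, rfl⟩)]
    have hall : (∀ d ∈ childCodes (Ψ.code id) (φ.code id), d ∈ L) ↔
        ∀ ψ, Child Ψ φ ψ → ψ.code id ∈ L := by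
      constructor
      · exact fun H ψ h => H _ (mem_childCodes.2 ⟨ψ, h, rfl⟩)
      · intro H d hd
        obtain ⟨ψ, h, rfl⟩ := mem_childCodes.1 hd
        exact H ψ h
    have hex : (∃ d ∈ childCodes (Ψ.code id) (φ.code id), d ∈ L) ↔
        ∃ ψ, Child Ψ φ ψ ∧ ψ.code id ∈ L := by
      constructor
      · rintro ⟨d, hd, hL⟩
        obtain ⟨ψ, h, rfl⟩ := mem_childCodes.1 hd
        exact ⟨ψ, h, hL⟩
      · exact fun ⟨ψ, h, hL⟩ => ⟨_, mem_childCodes.2 ⟨ψ, h, rfl⟩, hL⟩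
    rw [LocallyTrue, hall, hex]
    cases φ with
    | pos P =>
      rw [holds_pos hφ, ← hP (P := P) hc]
      simp [tag, arg, code]
    | neg P =>
      rw [holds_neg hφ, ← hP (P := P) hc]
      simp [tag, arg, code]
    | top => simp [tag, code, holds_top hφ]
    | bot => simp [tag, code, not_holds_bot]
    | and φ ψ =>
      rw [holds_and hφ, ← IH φ id (.and_left ..), ← IH ψ id (.and_right ..)]
      simp [tag, code, child_and_iff]
    | or φ ψ =>
      rw [holds_or hφ, ← IH φ id (.or_left ..), ← IH ψ id (.or_right ..)]
      simp [tag, code, child_or_iff]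
    | fix η X φ =>
      rw [holds_fix hφ, ← IH φ id (.fix ..)]
      cases η <;> simp [tag, code, child_fix_iff]
    | var X =>
      rw [holds_var hφ]
      simp only [tag, code, Nat.unpair_pair, child_var_iff]
      norm_num
      constructor
      · rintro ⟨ψ, ⟨η, h⟩, hL⟩
        exact ⟨η, ψ, h, (IH ψ id (.var _ _ _ h)).1 hL⟩
      · rintro ⟨η, ψ, h, hL⟩
        exact ⟨ψ, ⟨η, h⟩, (IH ψ id (.var _ _ _ h)).2 hL⟩
    | dia φ =>
      have hφ' := (Child.dia φ).mem_sub hφ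
      rw [holds_dia hφ]
      simp only [tag, arg, code, Nat.unpair_pair]
      norm_num
      constructor
      · rintro ⟨τ, hτ, h⟩
        obtain ⟨j, t, hj, hE, hm⟩ := hS₁ τ hτ
        exact ⟨j, hj, t, hE, (hm φ hφ').1 h⟩
      · rintro ⟨j, hj, t, hE, h⟩
        obtain ⟨τ, hτ, hm⟩ := hS₂ j t hj hE
        exact ⟨τ, hτ, (hm φ hφ').2 h⟩
    | box φ =>
      have hφ' := (Child.box φ).mem_sub hφ
      rw [holds_box hφ]
      simp only [tag, arg, code, Nat.unpair_pair]
      norm_num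
      constructor
      · intro H j hj t hE
        obtain ⟨τ, hτ, hm⟩ := hS₂ j t hj hE
        exact (hm φ hφ').1 (H τ hτ)
      · intro H τ hτ
        obtain ⟨j, t, hj, hE, hm⟩ := hS₁ τ hτ
        exact (hm φ hφ').2 (H j hj t hE)

end Spec

/-! ### Joining trees under a new root -/

section Join

variable {α : Type}

/-- The graph of `f`, which may be far from surjective, is a bisimulation. It serves to place a tree
below a new root. -/
theorem holds_iff_of_map {T T' : Kripke α} (f : T.S → T'.S)
    (hlabel : ∀ s, T'.label (f s) = T.label s)
    (hE : ∀ s t', T'.E (f s) t' ↔ ∃ t, T.E s t ∧ f t = t') {Ψ φ : Formula α} {k : ℕ} {s : T.S} :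
    Holds T Ψ k s φ ↔ Holds T' Ψ k (f s) φ := by
  refine exists_congr fun h => ?_
  refine win_iff_of_bisim (fun x y => y = ((f x.1.1, x.1.2), x.2)) ?_ ?_ ?_ rfl
  · rintro ⟨⟨s, φ, hφ⟩, k⟩ _ rfl
    change EvenOwns T s φ ↔ EvenOwns T' (f s) φ
    cases φ <;> simp [EvenOwns, hlabel]
  · rintro ⟨⟨s, φ, hφ⟩, k⟩ _ ⟨⟨t, ψ, hψ⟩, j⟩ rfl ⟨h, hm⟩
    refine ⟨((f t, ⟨ψ, hψ⟩), j), ⟨?_, hm⟩, rfl⟩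
    change GameEdge T Ψ (s, φ) (t, ψ) at h
    change GameEdge T' Ψ (f s, φ) (f t, ψ)
    cases h
    case dia h => exact .dia _ _ _ ((hE _ _).2 ⟨_, h, rfl⟩)
    case box h => exact .box _ _ _ ((hE _ _).2 ⟨_, h, rfl⟩)
    case var h => exact .var _ _ _ _ h
    all_goals constructor
  · rintro ⟨⟨s, φ, hφ⟩, k⟩ _ ⟨⟨t', ψ, hψ⟩, j⟩ rfl ⟨h, hm⟩
    change GameEdge T' Ψ (f s, φ) (t', ψ) at h
    suffices H : ∃ t, f t = t' ∧ GameEdge T Ψ (s, φ) (t, ψ) by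
      obtain ⟨t, rfl, hst⟩ := H
      exact ⟨((t, ⟨ψ, hψ⟩), j), ⟨hst, hm⟩, rfl⟩
    cases h
    case dia h =>
      obtain ⟨t, hst, rfl⟩ := (hE _ _).1 h
      exact ⟨t, rfl, .dia _ _ _ hst⟩
    case box h =>
      obtain ⟨t, hst, rfl⟩ := (hE _ _).1 h
      exact ⟨t, rfl, .box _ _ _ hst⟩
    case var h => exact ⟨s, rfl, .var _ _ _ _ h⟩
    all_goals exact ⟨s, rfl, by constructor⟩

/-- The tree whose root has label `a` and the roots of the trees `U i` as its successors. -/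
def Kripke.join (a : Set α) {ι : Type} (U : ι → Kripke α) : Kripke α where
  S := Option (Σ i, (U i).S)
  E
    | none, some y => y.2 = (U y.1).root
    | some x, some y => ∃ t, (U x.1).E x.2 t ∧ y = ⟨x.1, t⟩
    | _, none => False
  root := none
  label
    | none => a
    | some x => (U x.1).label x.2

theorem Kripke.join_root_edge {a : Set α} {ι : Type} {U : ι → Kripke α} {t : (join a U).S} :
    (join a U).E (join a U).root t ↔ ∃ i, t = some ⟨i, (U i).root⟩ := by
  cases t with
  | none => exact iff_of_false id (by rintro ⟨i, ⟨⟩⟩)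
  | some y =>
    obtain ⟨i, t⟩ := y
    constructor
    · rintro (rfl : t = (U i).root)
      exact ⟨i, rfl⟩
    · rintro ⟨j, h⟩
      cases h
      exact (rfl : (U i).root = (U i).root)

theorem Kripke.join_edge {a : Set α} {ι : Type} {U : ι → Kripke α} {i : ι} {s : (U i).S}
    {t : (join a U).S} :
    (join a U).E (some ⟨i, s⟩) t ↔ ∃ t', (U i).E s t' ∧ some ⟨i, t'⟩ = t := by
  cases t with
  | none => exact iff_of_false id (by rintro ⟨t, -, ⟨⟩⟩)
  | some y =>
    constructor
    · rintro ⟨t, h, rfl⟩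
      exact ⟨t, h, rfl⟩
    · rintro ⟨t, h, ht⟩
      exact ⟨t, h, (Option.some.inj ht).symm⟩

theorem holds_join {a : Set α} {ι : Type} {U : ι → Kripke α} {i : ι} {s : (U i).S}
    {Ψ φ : Formula α} {k : ℕ} :
    Holds (Kripke.join a U) Ψ k (some ⟨i, s⟩) φ ↔ Holds (U i) Ψ k s φ :=
  (holds_iff_of_map (T := U i) (T' := Kripke.join a U) (fun s => some ⟨i, s⟩) (fun _ => rfl)
    (fun _ _ => Kripke.join_edge)).symm

theorem Kripke.isRegularTree_join {a : Set α} (ha : a.Finite) {ι : Type} [Finite ι]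
    {U : ι → Kripke α} (hf : ∀ i, Finite (U i).S) (hU : ∀ i, (U i).IsRegularTree) :
    Finite (join a U).S ∧ (join a U).IsRegularTree := by
  have hfin : Finite (join a U).S := inferInstanceAs (Finite (Option (Σ i, (U i).S)))
  refine ⟨hfin, isRegularTree_of_finite ?_ ?_ ?_ ?_⟩
  · rintro (_ | ⟨i, s⟩)
    · exact .refl
    · have h := (hU i).reach s
      induction h with
      | refl => exact .single (join_root_edge.2 ⟨i, rfl⟩)
      | tail _ h ih => exact ih.tail (join_edge.2 ⟨_, h, rfl⟩)
  · rintro (_ | ⟨i, s⟩) h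
    · exact h
    · exact h
  · rintro s t (_ | ⟨i, u⟩) hs ht
    · cases s <;> exact hs.elim
    · rcases s with _ | ⟨j, s⟩ <;> rcases t with _ | ⟨k, t⟩
      · rfl
      · obtain ⟨t', ht, h⟩ := join_edge.1 ht
        cases h
        obtain rfl : u = (U i).root := hs
        exact ((hU i).root_min _ ht).elim
      · obtain ⟨s', hs, h⟩ := join_edge.1 hs
        cases h
        obtain rfl : u = (U i).root := ht
        exact ((hU i).root_min _ hs).elim
      · obtain ⟨s', hs, h⟩ := join_edge.1 hs
        cases h
        obtain ⟨t', ht, h⟩ := join_edge.1 ht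
        cases h
        rw [(hU i).pred_unique _ _ _ hs ht]
  · refine (ha.union (Set.finite_iUnion fun i => (hU i).finite_label)).subset ?_
    rintro x ⟨_ | ⟨i, s⟩, hx⟩
    · exact .inl hx
    · exact .inr (Set.mem_iUnion.2 ⟨i, s, hx⟩)

end Join

/-! ### Correctness of the computation of the semantic modal depth -/

section SemanticDepthOfCode

variable {Ψ : Formula ℕ}

theorem trueCodes_congr {c : ℕ} {a : List ℕ} {S S' : List (List ℕ)} (h : ∀ τ, τ ∈ S ↔ τ ∈ S') :
    trueCodes c a S = trueCodes c a S' := by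
  have : (fun L => (subCodes c).filter fun e => LocallyTrue c a S L e) =
      fun L => (subCodes c).filter fun e => LocallyTrue c a S' L e := by
    funext L
    refine List.filter_congr fun e _ => ?_
    simp only [LocallyTrue, h]
  rw [trueCodes, trueCodes, this]

theorem exists_label (c : ℕ) (A : Set ℕ) : ∃ a ∈ labels c, ∀ P ≤ c, P ∈ a ↔ P ∈ A := by
  classical
  refine ⟨(List.range (c + 1)).filter (· ∈ A), List.mem_sublists'.2 List.filter_sublist, ?_⟩
  intro P hP
  simp
  omega

theorem exists_leafType (hs : Ψ.IsSentence) (hn : Ψ.WellNamed) (hg : Ψ.Guarded)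
    (T : Kripke ℕ) (s : T.S) : ∃ τ ∈ leafTypes (Ψ.code id), Matches T Ψ 0 s τ := by
  obtain ⟨a, ha, h⟩ := exists_label (Ψ.code id) (T.label s)
  exact ⟨_, List.mem_map.2 ⟨a, ha, rfl⟩, matches_trueCodes hs hn hg h (by simp) (by simp)⟩

/-- Choose for `S` all pairs computed so far that some successor of `s` has. Only this finite set
matters, not the number of successors. -/
theorem exists_typePair (hs : Ψ.IsSentence) (hn : Ψ.WellNamed) (hg : Ψ.Guarded)
    (T : Kripke ℕ) (j : ℕ) (s : T.S) : ∃ x ∈ typePairs (Ψ.code id) j,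
      Matches T Ψ (j + 1) s x.1 ∧ Matches T Ψ j s x.2 := by
  classical
  induction j generalizing s with
  | zero =>
    obtain ⟨a, ha, h⟩ := exists_label (Ψ.code id) (T.label s)
    refine ⟨_, List.mem_flatMap.2 ⟨a, ha, List.mem_map.2 ⟨(leafTypes (Ψ.code id)).filter
      (fun τ => ∃ t, T.E s t ∧ Matches T Ψ 0 t τ), List.mem_sublists'.2 List.filter_sublist, rfl⟩⟩,
      matches_trueCodes hs hn hg h ?_ ?_, matches_trueCodes hs hn hg h (by simp) (by simp)⟩
    · intro τ hτ
      obtain ⟨t, ht⟩ := by simpa using (List.mem_filter.1 hτ).2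
      exact ⟨0, t, rfl, ht⟩
    · rintro j t hj hE
      obtain rfl : 0 = j := by omega
      obtain ⟨τ, hτ, hm⟩ := exists_leafType hs hn hg T t
      exact ⟨τ, List.mem_filter.2 ⟨hτ, by simpa using ⟨t, hE, hm⟩⟩, hm⟩
  | succ j ih =>
    obtain ⟨a, ha, h⟩ := exists_label (Ψ.code id) (T.label s)
    rw [typePairs, Function.iterate_succ_apply', ← typePairs]
    refine ⟨_, List.mem_flatMap.2 ⟨a, ha, List.mem_map.2 ⟨(typePairs (Ψ.code id) j).filter
      (fun x => ∃ t, T.E s t ∧ Matches T Ψ (j + 1) t x.1 ∧ Matches T Ψ j t x.2),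
      List.mem_sublists'.2 List.filter_sublist, rfl⟩⟩,
      matches_trueCodes hs hn hg h ?_ ?_, matches_trueCodes hs hn hg h ?_ ?_⟩
    · intro τ hτ
      obtain ⟨x, hx, rfl⟩ := List.mem_map.1 hτ
      obtain ⟨t, hE, ht, -⟩ := by simpa using (List.mem_filter.1 hx).2
      exact ⟨_, t, rfl, hE, ht⟩
    · rintro i t hi hE
      obtain rfl : j + 1 = i := by omega
      obtain ⟨x, hx, hm⟩ := ih t
      exact ⟨_, List.mem_map.2 ⟨x, List.mem_filter.2 ⟨hx, by simpa using ⟨t, hE, hm⟩⟩, rfl⟩, hm.1⟩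
    · intro τ hτ
      obtain ⟨x, hx, rfl⟩ := List.mem_map.1 hτ
      obtain ⟨t, hE, -, ht⟩ := by simpa using (List.mem_filter.1 hx).2
      exact ⟨_, t, rfl, hE, ht⟩
    · rintro i t hi hE
      obtain rfl : j = i := by omega
      obtain ⟨x, hx, hm⟩ := ih t
      exact ⟨_, List.mem_map.2 ⟨x, List.mem_filter.2 ⟨hx, by simpa using ⟨t, hE, hm⟩⟩, rfl⟩, hm.2⟩

/-- A joined tree has the computed types, if the parts have. -/
theorem matches_join (hs : Ψ.IsSentence) (hn : Ψ.WellNamed) (hg : Ψ.Guarded) {a : List ℕ} {ι : Type}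
    {U : ι → Kripke ℕ} {k : ℕ} {S : List (List ℕ)}
    (h₁ : ∀ τ ∈ S, ∃ i, Matches (U i) Ψ k (U i).root τ)
    (h₂ : ∀ i, ∃ τ ∈ S, Matches (U i) Ψ k (U i).root τ) :
    Matches (Kripke.join {P | P ∈ a} U) Ψ (k + 1) (Kripke.join {P | P ∈ a} U).root
      (trueCodes (Ψ.code id) a S) := by
  have hM : ∀ i τ, Matches (Kripke.join {P | P ∈ a} U) Ψ k (some ⟨i, (U i).root⟩) τ ↔
      Matches (U i) Ψ k (U i).root τ := fun i τ =>
    forall₂_congr fun φ _ => by rw [holds_join]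
  refine matches_trueCodes hs hn hg (fun _ _ => Iff.rfl) ?_ ?_
  · intro τ hτ
    obtain ⟨i, hi⟩ := h₁ τ hτ
    exact ⟨k, _, rfl, Kripke.join_root_edge.2 ⟨i, rfl⟩, (hM i τ).2 hi⟩
  · rintro j t hj hE
    obtain rfl : k = j := by omega
    obtain ⟨i, rfl⟩ := Kripke.join_root_edge.1 hE
    obtain ⟨τ, hτ, h⟩ := h₂ i
    exact ⟨τ, hτ, (hM i τ).2 h⟩

theorem matches_zero (hs : Ψ.IsSentence) (hn : Ψ.WellNamed) (hg : Ψ.Guarded) (a : List ℕ)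
    {ι : Type} (U : ι → Kripke ℕ) :
    Matches (Kripke.join {P | P ∈ a} U) Ψ 0 (Kripke.join {P | P ∈ a} U).root
      (trueCodes (Ψ.code id) a []) :=
  matches_trueCodes hs hn hg (fun _ _ => Iff.rfl) (by simp) (by simp)

theorem exists_tree_of_leafType (hs : Ψ.IsSentence) (hn : Ψ.WellNamed) (hg : Ψ.Guarded)
    {τ : List ℕ} (h : τ ∈ leafTypes (Ψ.code id)) :
    ∃ T : Kripke ℕ, (Finite T.S ∧ T.IsRegularTree) ∧ Matches T Ψ 0 T.root τ := by
  obtain ⟨a, -, rfl⟩ := List.mem_map.1 h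
  exact ⟨Kripke.join {P | P ∈ a} Empty.rec,
    Kripke.isRegularTree_join a.finite_toSet (fun i => i.elim) (fun i => i.elim),
    matches_zero hs hn hg a _⟩

/-- Realise each pair in the chosen list `S` by a finite tree and join these trees under a new root.
One tree realises both components at once, so the pair really compares two truncations of the same
tree. -/
theorem exists_tree_of_typePair (hs : Ψ.IsSentence) (hn : Ψ.WellNamed) (hg : Ψ.Guarded)
    {j : ℕ} {x : List ℕ × List ℕ} (h : x ∈ typePairs (Ψ.code id) j) :
    ∃ T : Kripke ℕ, (Finite T.S ∧ T.IsRegularTree) ∧ Matches T Ψ (j + 1) T.root x.1 ∧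
      Matches T Ψ j T.root x.2 := by
  induction j generalizing x with
  | zero =>
    obtain ⟨a, -, h⟩ := List.mem_flatMap.1 h
    obtain ⟨S, hS, rfl⟩ := List.mem_map.1 h
    have hS := (List.mem_sublists'.1 hS).subset
    choose U hU hm using fun τ : {τ // τ ∈ S} => exists_tree_of_leafType hs hn hg (hS τ.2)
    exact ⟨Kripke.join {P | P ∈ a} U,
      Kripke.isRegularTree_join a.finite_toSet (fun i => (hU i).1) (fun i => (hU i).2),
      matches_join hs hn hg (fun τ hτ => ⟨⟨τ, hτ⟩, hm _⟩) (fun i => ⟨i.1, i.2, hm i⟩),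
      matches_zero hs hn hg a U⟩
  | succ j ih =>
    rw [typePairs, Function.iterate_succ_apply', ← typePairs] at h
    obtain ⟨a, -, h⟩ := List.mem_flatMap.1 h
    obtain ⟨S, hS, rfl⟩ := List.mem_map.1 h
    have hS := (List.mem_sublists'.1 hS).subset
    choose U hU hm using fun x : {x // x ∈ S} => ih (hS x.2)
    refine ⟨Kripke.join {P | P ∈ a} U,
      Kripke.isRegularTree_join a.finite_toSet (fun i => (hU i).1) (fun i => (hU i).2),
      matches_join hs hn hg ?_ (fun i => ⟨_, List.mem_map_of_mem i.2, (hm i).1⟩),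
      matches_join hs hn hg ?_ (fun i => ⟨_, List.mem_map_of_mem i.2, (hm i).2⟩)⟩
    · intro τ hτ
      obtain ⟨x, hx, rfl⟩ := List.mem_map.1 hτ
      exact ⟨⟨x, hx⟩, (hm _).1⟩
    · intro τ hτ
      obtain ⟨x, hx, rfl⟩ := List.mem_map.1 hτ
      exact ⟨⟨x, hx⟩, (hm _).2⟩

theorem tellsApart_typePairs_iff (hs : Ψ.IsSentence) (hn : Ψ.WellNamed) (hg : Ψ.Guarded) (j : ℕ) :
    TellsApart (Ψ.code id) (typePairs (Ψ.code id) j) ↔ Separates Ψ j := by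
  constructor
  · rintro ⟨x, hx, h⟩
    obtain ⟨T, ⟨-, hT⟩, h₁, h₂⟩ := exists_tree_of_typePair hs hn hg hx
    rw [h₁ _ Ψ.self_mem_sub, h₂ _ Ψ.self_mem_sub] at h
    exact ⟨T, hT, h⟩
  · rintro ⟨T, -, h⟩
    obtain ⟨x, hx, h₁, h₂⟩ := exists_typePair hs hn hg T j T.root
    rw [← h₁ _ Ψ.self_mem_sub, ← h₂ _ Ψ.self_mem_sub] at h
    exact ⟨x, hx, h⟩

/-! ### The bound on the search, from eventual periodicity. -/

/-- In a sequence in a finite set where each term is determined by the preceding one, a property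
that holds eventually holds from the cardinality of the set on. -/
theorem forall_card_le_of_eventually {β : Type*} {x : ℕ → β} {s : Finset β} (hs : ∀ j, x j ∈ s)
    (hx : ∀ i j, x i = x j → x (i + 1) = x (j + 1)) {P : β → Prop} {N : ℕ}
    (hN : ∀ j, N ≤ j → P (x j)) {j : ℕ} (hj : s.card ≤ j) : P (x j) := by
  obtain ⟨i, i', hi, hii', h⟩ : ∃ i i', i' ≤ s.card ∧ i < i' ∧ x i = x i' := by
    obtain ⟨i, hi, i', hi', hne, h⟩ := Finset.exists_ne_map_eq_of_card_lt_of_maps_to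
      (s := Finset.range (s.card + 1)) (t := s) (by simp) (fun j _ => hs j)
    rw [Finset.mem_range] at hi hi'
    rcases lt_or_gt_of_ne hne with h' | h'
    · exact ⟨i, i', by omega, h', h⟩
    · exact ⟨i', i, by omega, h', h.symm⟩
  have hstep : ∀ k, x (i + k) = x (i' + k) := by
    intro k
    induction k with
    | zero => exact h
    | succ k ih => exact hx _ _ ih
  have hper : ∀ t, x j = x (j + t * (i' - i)) := by
    intro t
    induction t with
    | zero => simp
    | succ t ih =>
      -- The subtraction is exact because `i < i' ≤ s.card ≤ j`.
      have := hstep (j + t * (i' - i) - i)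
      rw [show i + (j + t * (i' - i) - i) = j + t * (i' - i) by omega,
        show i' + (j + t * (i' - i) - i) = j + (t + 1) * (i' - i) by rw [add_mul]; omega] at this
      rw [ih, this]
  -- Going around the cycle `N` times moves the index beyond `N` without changing the term.
  rw [hper N]
  exact hN _ ((Nat.le_mul_of_pos_right N (by omega)).trans (Nat.le_add_left _ _))

theorem trueCodes_mem_sublists' (c : ℕ) (a : List ℕ) (S : List (List ℕ)) :
    trueCodes c a S ∈ (subCodes c).sublists' := by
  have h : (c + 1) * (c + 1) = ((c + 1) * (c + 1) - 1) + 1 := by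
    have : 0 < (c + 1) * (c + 1) := by positivity
    omega
  rw [trueCodes, h, Function.iterate_succ_apply', List.mem_sublists']
  exact List.filter_sublist

theorem mem_sublists'_of_mem_typePairs {c j : ℕ} {x : List ℕ × List ℕ} (h : x ∈ typePairs c j) :
    x.1 ∈ (subCodes c).sublists' ∧ x.2 ∈ (subCodes c).sublists' := by
  cases j with
  | zero =>
    obtain ⟨a, -, h⟩ := List.mem_flatMap.1 h
    obtain ⟨S, -, rfl⟩ := List.mem_map.1 h
    exact ⟨trueCodes_mem_sublists' .., trueCodes_mem_sublists' ..⟩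
  | succ j =>
    rw [typePairs, Function.iterate_succ_apply'] at h
    obtain ⟨a, -, h⟩ := List.mem_flatMap.1 h
    obtain ⟨S, -, rfl⟩ := List.mem_map.1 h
    exact ⟨trueCodes_mem_sublists' .., trueCodes_mem_sublists' ..⟩

/-- A sublist of `D` need not be a sublist of `D'`, where the order may differ. Filtering `D'` gives
one with the same members, and `trueCodes` depends only on these. Hence the next stage depends only
on the set of pairs. -/
theorem nextPairs_subset {c : ℕ} {D D' : List (List ℕ × List ℕ)} (h : D ⊆ D') :
    nextPairs c D ⊆ nextPairs c D' := by
  intro x hx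
  obtain ⟨a, ha, hx⟩ := List.mem_flatMap.1 hx
  obtain ⟨S, hS, rfl⟩ := List.mem_map.1 hx
  have hS := (List.mem_sublists'.1 hS).subset
  have hmem : ∀ x, x ∈ S ↔ x ∈ D'.filter (· ∈ S) := fun x => by
    simpa using fun hx => h (hS hx)
  refine List.mem_flatMap.2 ⟨a, ha, List.mem_map.2
    ⟨D'.filter (· ∈ S), List.mem_sublists'.2 List.filter_sublist, ?_⟩⟩
  rw [trueCodes_congr (S := S.map Prod.fst) (S' := (D'.filter (· ∈ S)).map Prod.fst),
    trueCodes_congr (S := S.map Prod.snd) (S' := (D'.filter (· ∈ S)).map Prod.snd)]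
  · intro τ
    simp only [List.mem_map, ← hmem]
  · intro τ
    simp only [List.mem_map, ← hmem]

theorem semanticModalDepthOfCode_eq (hs : Ψ.IsSentence) (hn : Ψ.WellNamed) (hg : Ψ.Guarded)
    (h : SemanticallyModal Ψ) :
    semanticModalDepthOfCode (Ψ.code id) = semanticModalDepth Ψ := by
  classical
  have hlt : ∀ j, semanticModalDepth Ψ ≤ j →
      ¬ TellsApart (Ψ.code id) (typePairs (Ψ.code id) j) := fun j hj => by
    rw [tellsApart_typePairs_iff hs hn hg]
    exact not_separates_of_le id hs hn hg h hj
  have hsucc : ∀ j, semanticModalDepth Ψ = j + 1 →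
      TellsApart (Ψ.code id) (typePairs (Ψ.code id) j) := fun j hj => by
    rw [tellsApart_typePairs_iff hs hn hg]
    exact separates_of_eq_succ id hs hn hg h hj
  refine lastSucc_eq ?_ hlt hsucc
  -- If the depth exceeded the bound, its predecessor `j` would be at least the bound and still tell
  -- pairs apart. But the sets of pairs are eventually not told apart, so by periodicity they are
  -- not from the bound on.
  by_contra! hB
  obtain ⟨j, hj⟩ : ∃ j, semanticModalDepth Ψ = j + 1 := ⟨semanticModalDepth Ψ - 1, by omega⟩
  let sl := (subCodes (Ψ.code id)).sublists'.toFinset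
  have hsl : sl.card ≤ 2 ^ (subCodes (Ψ.code id)).length :=
    (List.toFinset_card_le _).trans (List.length_sublists' _).le
  have hcard : (sl ×ˢ sl).powerset.card ≤ typePairsBound (Ψ.code id) := by
    rw [Finset.card_powerset, Finset.card_product]
    exact Nat.pow_le_pow_right (by norm_num) (Nat.mul_le_mul hsl hsl)
  refine forall_card_le_of_eventually (x := fun j => (typePairs (Ψ.code id) j).toFinset)
    (s := (sl ×ˢ sl).powerset) (P := fun D => ¬ ∃ x ∈ D, ¬ (Ψ.code id ∈ x.1 ↔ Ψ.code id ∈ x.2))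
    (N := semanticModalDepth Ψ) (j := j) ?_ ?_ ?_ (by omega) ?_
  · intro j
    rw [Finset.mem_powerset]
    intro x hx
    obtain ⟨h₁, h₂⟩ := mem_sublists'_of_mem_typePairs (List.mem_toFinset.1 hx)
    exact Finset.mem_product.2 ⟨List.mem_toFinset.2 h₁, List.mem_toFinset.2 h₂⟩
  · intro i j hij
    have hmem : ∀ x, x ∈ typePairs (Ψ.code id) i ↔ x ∈ typePairs (Ψ.code id) j := fun x => by
      rw [← List.mem_toFinset, ← List.mem_toFinset]
      exact iff_of_eq (congrArg (x ∈ ·) hij)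
    ext x
    simp only [List.mem_toFinset]
    rw [typePairs, typePairs, Function.iterate_succ_apply', Function.iterate_succ_apply',
      ← typePairs, ← typePairs]
    exact ⟨fun h => nextPairs_subset (fun y => (hmem y).1) h,
      fun h => nextPairs_subset (fun y => (hmem y).2) h⟩
  · rintro j hj ⟨x, hx, H⟩
    exact hlt j hj ⟨x, List.mem_toFinset.1 hx, H⟩
  · obtain ⟨x, hx, H⟩ := hsucc j hj
    exact ⟨x, List.mem_toFinset.2 hx, H⟩

end SemanticDepthOfCode

/-! ### Interpretation -/

theorem Formula.OrderPreserving.prio_game {Ψ : Formula ℕ} (hs : Ψ.IsSentence) {l q : ℕ} {Ω : ℕ → ℕ}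
    (hΩ : Ψ.OrderPreserving l q Ω) (T : Kripke ℕ) (v : (game T Ψ l Ω).V) :
    l ≤ (game T Ψ l Ω).prio v ∧ (game T Ψ l Ω).prio v ≤ q := by
  obtain ⟨s, φ, hφ⟩ := v
  cases φ with
  | var X =>
    obtain ⟨η, ψ, h, -⟩ := hs.exists_binding hφ (Y := X) rfl
    exact hΩ.range _ _ _ h
  | _ => exact ⟨le_rfl, hΩ.le⟩

theorem interprets_boundedFormula {Ψ : Formula ℕ} (hs : Ψ.IsSentence) (hn : Ψ.WellNamed)
    (hg : Ψ.Guarded) (h : SemanticallyModal Ψ) {l q : ℕ} {Ω : ℕ → ℕ}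
    (hΩ : Ψ.OrderPreserving l q Ω) :
    Interprets (boundedFormula l q Ψ.modalityFreeLength Ψ.modalityFreeLength
      (semanticModalDepth Ψ)) Ψ l Ω := by
  intro T hT
  have hp := marksWithin_game id hs hn hg T l Ω
  rw [sat_boundedFormula (hΩ.prio_game hs T) hp, evenWins_bounded_iff_holds hp]
  exact modalAt_semanticModalDepth id hs hn hg h T hT

end Lmu

theorem mainTheorem2 :
    -- one algorithm, applied to the code of `Ψ` and the bounds of the index `{l, ..., q}`,
    -- computes a modal formula that interprets `Ψ`, and this formula is `Bounded_{p,m}`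
    (∃ g : ℕ × ℕ × ℕ → ℕ, Computable g ∧
      ∀ Ψ : Lmu.Formula ℕ, Ψ.IsSentence → Ψ.WellNamed → Ψ.Guarded → Lmu.SemanticallyModal Ψ →
        ∀ l q : ℕ, l ≤ 1 → l ≤ q →
          ∃ Φ : Lmu.Formula Lmu.GameProp,
            g (Ψ.code id, l, q) = Φ.code Lmu.GameProp.code ∧
            Φ.IsModal ∧
            (∀ Ω : ℕ → ℕ, Ψ.OrderPreserving l q Ω → Lmu.Interprets Φ Ψ l Ω) ∧
            Φ = Lmu.boundedFormula l q Ψ.modalityFreeLength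
              Ψ.modalityFreeLength (Lmu.semanticModalDepth Ψ)) ∧
    -- `Bounded_{p,n}` describes the winning regions of `n`-bounded parity games
    (∀ (A : Lmu.Arena) (l q p n : ℕ), (∀ v, l ≤ A.prio v ∧ A.prio v ≤ q) → A.MarksWithin p →
      (Lmu.Sat A.toTree (Lmu.boundedFormula l q p p n) ↔ (A.bounded n).EvenWins)) ∧
    -- the `n`-bounded model-checking game simulates the game on the tree truncated at depth `n`,
    -- and in it marked positions are at most `p` moves apart
    (∀ Ψ : Lmu.Formula ℕ, Ψ.IsSentence → Ψ.WellNamed → Ψ.Guarded →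
      ∀ (l q : ℕ) (Ω : ℕ → ℕ), Ψ.OrderPreserving l q Ω →
        ∀ T : Lmu.Kripke ℕ, T.IsRegularTree →
          (Lmu.game T Ψ l Ω).MarksWithin Ψ.modalityFreeLength ∧
          ∀ n : ℕ, ((Lmu.game T Ψ l Ω).bounded n).EvenWins ↔
            (Lmu.game (T.truncate n) Ψ l Ω).EvenWins) := by

  refine ⟨⟨Lmu.interpretingCode, Lmu.computable_interpretingCode, ?_⟩, ?_, ?_⟩
  · intro Ψ hs hn hg h l q _ _
    refine ⟨_, ?_, Lmu.isModal_boundedFormula _ _ _ _ _,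
      fun Ω hΩ => Lmu.interprets_boundedFormula hs hn hg h hΩ, rfl⟩
    rw [Lmu.code_boundedFormula, Lmu.interpretingCode,
      Lmu.modalityFreeLengthOfCode_eq hs hn hg, Lmu.semanticModalDepthOfCode_eq hs hn hg h]
  · intro A l q p n hA hp
    exact Lmu.sat_boundedFormula hA hp n
  · intro Ψ hs hn hg l q Ω _ T hT
    have hp := Lmu.marksWithin_game id hs hn hg T l Ω
    exact ⟨hp, fun n => (Lmu.evenWins_bounded_iff_holds hp n).trans
      (Lmu.evenWins_truncate_iff_holds hT hp n).symm⟩
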